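/- **Setting.** A stent $\mathcal N$ is a finite connected oriented graph without loops, with $n_{\mathcal V}$ vertices placed at points of $\mathbb R^3$ and $n_{\mathcal E}\ge 1$ edges. Edge $i$ is a rod of length $\ell^i>0$ with $C^1$ arc-length parametrized middle curve $\Phi^i:[0,\ell^i]\to\mathbb R^3$, $t^i=(\Phi^i)'$, running from the position of the vertex that the edge leaves (at $s=0$) to the position of the vertex that it enters (at $s=\ell^i$). It carries (measurable) rotation matrices $Q^i=[t^i,n^i,b^i]\in SO(3)$ along the rod and $H^i=\mathrm{diag}(\mu^iK^i,E^iI_n^i,E^iI_b^i)$ with positive constants. Let $J_j^+$, $J_j^-$ be the sets of edges entering, leaving the vertex $j$, and for $P\in(\mathbb R^3)^{n_{\mathcal E}}$ put $(A^\pm P)^j=\sum_{i\in J_j^\pm}P^i$. Let $$V=L^2(\mathcal N)\times L^2(\mathcal N)\times(\mathbb R^{3n_{\mathcal E}})^4\times\mathbb R^3\times\mathbb R^3,\qquad M=L^2_{H^1}(\mathcal N)\times L^2_{H^1}(\mathcal N)\times(\mathbb R^{3n_{\mathcal V}})^2,$$ where $L^2(\mathcal N)=\prod_iL^2(0,\ell^i;\mathbb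 R^3)$ and $L^2_{H^1}(\mathcal N)=\prod_iH^1(0,\ell^i;\mathbb R^3)$, with the Hilbert product norms. For $\Sigma=(q,p,P_+,P_-,Q_+,Q_-,\alpha,\beta)$, $\Gamma=(\xi,\dots)\in V$ and $\psi=(v,w,\mathsf V,\mathsf W)\in M$ let $$a(\Sigma,\Gamma)=\sum_i\int_0^{\ell^i}Q^i(H^i)^{-1}(Q^i)^Tq^i\cdot\xi^i\,ds,$$ $$\begin{aligned}b(\Sigma,\psi)=&\sum_i\int_0^{\ell^i}\bigl(-p^i\cdot(\partial_sv^i+t^i\times w^i)-q^i\cdot\partial_sw^i\bigr)ds+\sum_i\bigl(P^i_+\cdot v^i(\ell^i)-P^i_-\cdot v^i(0)\bigr)+\sum_i\bigl(Q^i_+\cdot w^i(\ell^i)-Q^i_-\cdot w^i(0)\bigr)\\&-(A^+P_+-A^-P_-)\cdot \mathsf V-(A^+Q_+-A^-Q_-)\cdot \mathsf W+\alpha\cdot\sum_i\int_0^{\ell^i}v^i\,ds+\beta\cdot\sum_i\int_0^{\ell^i}w^i\,ds,\end{aligned}$$ and, for a load $f\in L^2(\mathcal N)$, $F_f(\psi)=-\sum_i\int_0^{\ell^i}f^i\cdot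 v^i\,ds$. The continuous problem asks for $(\Sigma,\varphi)\in V\times M$ with $$a(\Sigma,\Gamma)+b(\Gamma,\varphi)=0\quad(\Gamma\in V),\qquad b(\Sigma,\psi)=F_f(\psi)\quad(\psi\in M).$$ Let $V_k\subset V$ be the subspace where $q,p$ are polynomials of degree at most $k$ on each edge, and $M_n\subset M$ the subspace where the two function components are polynomials of degree at most $n$ on each edge. The discrete problem is the same system with $V,M$ replaced by $V_k,M_n$. **Theorem 4.5.** Let all struts be straight, i.e. $\ell^it^i=\Phi^i(\ell^i)-\Phi^i(0)$, and let the geometry be such that $\sum_{i\in J^+_j}\alpha_it^i-\sum_{i\in J^-_j}\alpha_it^i=0$ for all vertices $j$ implies $\alpha_i=0$ for all $i$. Let $k\ge 0$ and $n=k+1$. Then there is a constant $c>0$, depending only on $\mathcal N$ and $k$, such that for every load $f\in L^2(\mathcal N)$, every solution $(\Sigma,\varphi)\in V\times M$ of the continuous problem and every solution $(\Sigma^h,\varphi^h)\in V_k\times M_n$ of the discrete problem, where in the lowest-order case $k=0$ the solution of the discrete problem is in addition supposed to be unique, $$\|\Sigma-\Sigma^h\|_V+\|\varphi-\varphi^h\|_M\le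 c\Bigl(\inf_{\Gamma^h\in V_k}\|\Sigma-\Gamma^h\|_V+\inf_{\psi^h\in M_n}\|\varphi-\psi^h\|_M\Bigr).$$ -/

import Mathlib

open MeasureTheory Set
open scoped ContDiff

noncomputable section

/-! ### Spaces on one strut -/

/-- `ℝ³` with its Euclidean norm and inner product. -/
abbrev E3 : Type := EuclideanSpace ℝ (Fin 3)

/-- The cross product on `ℝ³`. -/
def cross (x y : E3) : E3 := WithLp.toLp 2 (crossProduct x.ofLp y.ofLp)

/-- Lebesgue measure on `(0, l)`. -/
abbrev strutMeasure (l : ℝ) : Measure ℝ := volume.restrict (Ioo 0 l)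

/-- `L²(0, l; ℝ³)`. -/
abbrev L2 (l : ℝ) : Type := Lp E3 2 (strutMeasure l)

/-- `g` is the weak derivative of `v` on `(0, l)`. -/
def IsWeakDeriv (l : ℝ) (v g : ℝ → E3) : Prop :=
  ∀ η : ℝ → ℝ, ContDiff ℝ ∞ η → HasCompactSupport η → tsupport η ⊆ Ioo 0 l →
    ∫ s in Ioo 0 l, deriv η s • v s = -∫ s in Ioo 0 l, η s • g s

/-- A weakly differentiable scalar function on an interval is a.e. a primitive. -/
theorem weakDeriv_scalar {l : ℝ} (hl : 0 < l) {v g : ℝ → ℝ}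
    (hv : IntervalIntegrable v volume 0 l) (hg : IntervalIntegrable g volume 0 l)
    (h : ∀ η : ℝ → ℝ, ContDiff ℝ ∞ η → HasCompactSupport η → tsupport η ⊆ Ioo 0 l →
      ∫ s in (0 : ℝ)..l, deriv η s * v s = -∫ s in (0 : ℝ)..l, η s * g s) :
    ∃ c : ℝ, ∀ᵐ s, s ∈ Ioo 0 l → v s = c + ∫ t in (0 : ℝ)..s, g t := by
  set G : ℝ → ℝ := fun s => ∫ t in (0 : ℝ)..s, g t with hG
  have hGac : AbsolutelyContinuousOnInterval G 0 l :=
    hg.absolutelyContinuousOnInterval_intervalIntegral (c := 0) (by simp)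
  have hGd : ∀ᵐ s, s ∈ uIcc 0 l → deriv G s = g s := by
    filter_upwards [hg.ae_hasDerivAt_integral] with s hs hs'
    exact (hs hs' 0 (by simp)).deriv
  have hGi : IntervalIntegrable G volume 0 l := hGac.continuousOn.intervalIntegrable
  have hw : IntervalIntegrable (fun s => v s - G s) volume 0 l := hv.sub hGi
  -- the difference `v - G` is orthogonal to derivatives of test functions
  have key : ∀ η : ℝ → ℝ, ContDiff ℝ ∞ η → HasCompactSupport η → tsupport η ⊆ Ioo 0 l →
      ∫ s in (0 : ℝ)..l, deriv η s * (v s - G s) = 0 := by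
    intro η h1 h2 h3
    have hη0 : ∀ x, x ∉ Ioo 0 l → η x = 0 := fun x hx =>
      image_eq_zero_of_notMem_tsupport fun hx' => hx (h3 hx')
    have hdc : Continuous (deriv η) := h1.continuous_deriv (by simp)
    have hηac : AbsolutelyContinuousOnInterval η 0 l :=
      (h1.of_le (by simp)).contDiffOn.absolutelyContinuousOnInterval
    have e1 := hGac.integral_mul_deriv_eq_deriv_mul hηac
    rw [hη0 0 (by simp), hη0 l (by simp)] at e1
    have e2 : ∫ s in (0 : ℝ)..l, deriv G s * η s = ∫ s in (0 : ℝ)..l, η s * g s := by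
      apply intervalIntegral.integral_congr_ae
      filter_upwards [hGd] with s hs hs'
      rw [hs (uIoc_subset_uIcc hs'), mul_comm]
    have e3 : ∫ s in (0 : ℝ)..l, deriv η s * (v s - G s)
        = (∫ s in (0 : ℝ)..l, deriv η s * v s) - ∫ s in (0 : ℝ)..l, G s * deriv η s := by
      rw [← intervalIntegral.integral_sub (hv.continuousOn_mul hdc.continuousOn)
        (hGi.mul_continuousOn hdc.continuousOn)]
      congr 1; ext s; ring
    rw [e3, h η h1 h2 h3, e1, e2]; ring
  -- a fixed bump function of integral one
  let φ : ContDiffBump (l / 2) := ⟨l / 8, l / 4, by positivity, by linarith⟩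
  set ρ : ℝ → ℝ := φ.normed volume with hρ
  have hρc : ContDiff ℝ ∞ ρ := φ.contDiff_normed
  have hρi : ∫ s, ρ s = 1 := φ.integral_normed
  have hρs : tsupport ρ = Metric.closedBall (l / 2) (l / 4) := φ.tsupport_normed_eq
  have hρcs : HasCompactSupport ρ := φ.hasCompactSupport_normed
  have hρsub : tsupport ρ ⊆ Ioo 0 l := by
    rw [hρs, Real.closedBall_eq_Icc]
    intro x hx; constructor <;> linarith [hx.1, hx.2]
  set c : ℝ := ∫ s in (0 : ℝ)..l, ρ s * (v s - G s) with hc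
  refine ⟨c, ?_⟩
  have hloc : LocallyIntegrableOn (fun s => v s - G s - c) (Ioo 0 l) volume := by
    have : IntervalIntegrable (fun s => v s - G s - c) volume 0 l :=
      hw.sub intervalIntegrable_const
    exact (((intervalIntegrable_iff_integrableOn_Ioo_of_le hl.le).1 this)).locallyIntegrableOn
  have fin := isOpen_Ioo.ae_eq_zero_of_integral_contDiff_smul_eq_zero hloc ?_
  · filter_upwards [fin] with s hs hs'
    have := hs hs'
    linarith
  intro ζ z1 z2 z3
  have vanish : ∀ f : ℝ → ℝ, tsupport f ⊆ Ioo 0 l → ∀ x, x ∉ Ioo 0 l → f x = 0 :=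
    fun f hf x hx => image_eq_zero_of_notMem_tsupport fun hx' => hx (hf hx')
  set I : ℝ := ∫ s, ζ s with hI
  set κ : ℝ → ℝ := fun s => ζ s - I * ρ s with hκ
  have hκc : ContDiff ℝ ∞ κ := z1.sub (contDiff_const.mul hρc)
  -- a compact subinterval carrying both supports
  obtain ⟨a, b, ha, hb, hab⟩ : ∃ a b : ℝ, 0 < a ∧ b < l ∧ ∀ x, κ x ≠ 0 → x ∈ Icc a b := by
    have hK : IsCompact (tsupport ζ ∪ tsupport ρ) := z2.isCompact.union hρcs.isCompact
    have hKs : tsupport ζ ∪ tsupport ρ ⊆ Ioo 0 l := union_subset z3 hρsub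
    have hne : (tsupport ζ ∪ tsupport ρ).Nonempty := by
      refine ⟨l / 2, Or.inr ?_⟩
      rw [hρs]; exact Metric.mem_closedBall_self (by positivity)
    refine ⟨sInf (tsupport ζ ∪ tsupport ρ), sSup (tsupport ζ ∪ tsupport ρ),
      (hKs (hK.sInf_mem hne)).1, (hKs (hK.sSup_mem hne)).2, fun x hx => ?_⟩
    have hx' : x ∈ tsupport ζ ∪ tsupport ρ := by
      by_contra hcon
      simp only [mem_union, not_or] at hcon
      exact hx (by simp [hκ, image_eq_zero_of_notMem_tsupport hcon.1,
        image_eq_zero_of_notMem_tsupport hcon.2])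
    exact ⟨csInf_le hK.bddBelow hx', le_csSup hK.bddAbove hx'⟩
  have hκi : ∀ x y, IntervalIntegrable κ volume x y := fun x y =>
    hκc.continuous.intervalIntegrable x y
  have hful : ∀ f : ℝ → ℝ, (∀ x, x ∉ Ioo 0 l → f x = 0) → ∫ s in (0 : ℝ)..l, f s = ∫ s, f s := by
    intro f hf
    rw [intervalIntegral.integral_of_le hl.le, integral_Ioc_eq_integral_Ioo]
    exact setIntegral_eq_integral_of_forall_compl_eq_zero hf
  have hζl : ∫ s in (0 : ℝ)..l, ζ s = I := hful ζ (vanish ζ z3)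
  have hρl : ∫ s in (0 : ℝ)..l, ρ s = 1 := (hful ρ (vanish ρ hρsub)).trans hρi
  have hκ0 : ∫ s in (0 : ℝ)..l, κ s = 0 := by
    have e : ∫ s in (0 : ℝ)..l, κ s
        = (∫ s in (0 : ℝ)..l, ζ s) - ∫ s in (0 : ℝ)..l, I * ρ s :=
      intervalIntegral.integral_sub (z1.continuous.intervalIntegrable _ _)
        ((continuous_const.mul hρc.continuous).intervalIntegrable _ _)
    rw [e, intervalIntegral.integral_const_mul, hζl, hρl]
    ring
  set η : ℝ → ℝ := fun x => ∫ s in (0 : ℝ)..x, κ s with hη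
  have hηd : ∀ x, HasDerivAt η (κ x) x := fun x =>
    intervalIntegral.integral_hasDerivAt_right (hκi 0 x)
      (hκc.continuous.stronglyMeasurableAtFilter _ _) hκc.continuous.continuousAt
  have hηderiv : deriv η = κ := funext fun x => (hηd x).deriv
  have hηc : ContDiff ℝ ∞ η := by
    rw [contDiff_infty_iff_deriv]
    exact ⟨fun x => (hηd x).differentiableAt, hηderiv ▸ hκc⟩
  have hsupp : tsupport η ⊆ Icc a b := by
    refine closure_minimal (fun x hx => ?_) isClosed_Icc
    by_contra hcon
    apply hx
    rw [mem_Icc, not_and_or, not_le, not_le] at hcon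
    rcases hcon with hcon | hcon
    · have : ∀ s ∈ uIcc 0 x, κ s = 0 := by
        intro s hs
        by_contra hs0
        have h1 := (hab s hs0).1
        have h2 : s ≤ max 0 x := hs.2
        rcases max_cases 0 x with h | h <;> linarith
      change ∫ s in (0 : ℝ)..x, κ s = 0
      rw [intervalIntegral.integral_congr this]; simp
    · have : ∀ s ∈ uIcc x l, κ s = 0 := by
        intro s hs
        by_contra hs0
        have h1 := (hab s hs0).2
        have h2 : min x l ≤ s := hs.1
        rcases min_cases x l with h | h <;> linarith
      change ∫ s in (0 : ℝ)..x, κ s = 0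
      have e := intervalIntegral.integral_add_adjacent_intervals (hκi 0 x) (hκi x l)
      rw [hκ0, intervalIntegral.integral_congr this] at e
      simpa using e
  have hηcs : HasCompactSupport η := isCompact_Icc.of_isClosed_subset isClosed_closure hsupp
  have hηs : tsupport η ⊆ Ioo 0 l := fun x hx =>
    ⟨ha.trans_le (hsupp hx).1, (hsupp hx).2.trans_lt hb⟩
  have k := key η hηc hηcs hηs
  rw [hηderiv] at k
  have i1 : IntervalIntegrable (fun s => ζ s * (v s - G s)) volume 0 l :=
    hw.continuousOn_mul z1.continuous.continuousOn
  have i2 : IntervalIntegrable (fun s => ρ s * (v s - G s)) volume 0 l :=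
    hw.continuousOn_mul hρc.continuous.continuousOn
  have k2 : ∫ s in (0 : ℝ)..l, κ s * (v s - G s)
      = (∫ s in (0 : ℝ)..l, ζ s * (v s - G s)) - I * c := by
    rw [hc, ← intervalIntegral.integral_const_mul, ← intervalIntegral.integral_sub i1
      (i2.const_mul I)]
    congr 1; ext s; simp only [hκ]; ring
  rw [← hful (fun s => ζ s • (v s - G s - c)) fun x hx => by simp [vanish ζ z3 x hx]]
  have k3 : ∫ s in (0 : ℝ)..l, ζ s • (v s - G s - c)
      = (∫ s in (0 : ℝ)..l, ζ s * (v s - G s)) - I * c := by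
    rw [← hζl, ← intervalIntegral.integral_mul_const, ← intervalIntegral.integral_sub i1
      ((z1.continuous.intervalIntegrable _ _).mul_const c)]
    congr 1; ext s; simp only [smul_eq_mul]; ring
  rw [k3, ← k2, k]

theorem L2.integrable {l : ℝ} (v : L2 l) : Integrable v (strutMeasure l) :=
  (Lp.memLp v).integrable (by norm_num)

theorem smul_L2_integrable {l : ℝ} (v : L2 l) {η : ℝ → ℝ} (h1 : Continuous η)
    (h2 : HasCompactSupport η) : Integrable (fun s => η s • v s) (strutMeasure l) := by
  obtain ⟨C, hC⟩ := h2.exists_bound_of_continuous h1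
  exact v.integrable.bdd_smul C h1.aestronglyMeasurable (Filter.Eventually.of_forall hC)

/-- `H¹(0, l; ℝ³)`: the pairs `(v, v')` in `L² × L²` such that `v'` is the weak derivative of `v`
(which determines `v'`). The inherited norm is the usual one, `(‖v‖² + ‖v'‖²)^(1/2)` with `L²`
norms. -/
def H1Submodule (l : ℝ) : Submodule ℝ (WithLp 2 (L2 l × L2 l)) where
  carrier := {z | IsWeakDeriv l z.fst z.snd}
  zero_mem' := by
    intro η _ _ _
    have h0 : ((0 : L2 l) : ℝ → E3) =ᵐ[strutMeasure l] 0 := Lp.coeFn_zero _ _ _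
    have e1 : ∫ s in Ioo 0 l, deriv η s • (0 : L2 l) s = 0 := by
      refine integral_eq_zero_of_ae ?_
      filter_upwards [h0] with s hs
      rw [hs]; simp
    have e2 : ∫ s in Ioo 0 l, η s • (0 : L2 l) s = 0 := by
      refine integral_eq_zero_of_ae ?_
      filter_upwards [h0] with s hs
      rw [hs]; simp
    change ∫ s in Ioo 0 l, deriv η s • (0 : L2 l) s = -∫ s in Ioo 0 l, η s • (0 : L2 l) s
    rw [e1, e2, neg_zero]
  add_mem' := by
    intro z z' hz hz' η h1 h2 h3
    have key : ∀ (x y : L2 l) (θ : ℝ → ℝ), Continuous θ → HasCompactSupport θ →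
        ∫ s in Ioo 0 l, θ s • (x + y : L2 l) s
          = (∫ s in Ioo 0 l, θ s • x s) + ∫ s in Ioo 0 l, θ s • y s := by
      intro x y θ t1 t2
      rw [← integral_add (smul_L2_integrable x t1 t2) (smul_L2_integrable y t1 t2)]
      refine integral_congr_ae ?_
      filter_upwards [Lp.coeFn_add x y] with s hs
      rw [hs, Pi.add_apply, smul_add]
    have k1 := key z.fst z'.fst (deriv η) (h1.continuous_deriv (by simp)) h2.deriv
    have k2 := key z.snd z'.snd η h1.continuous h2
    change ∫ s in Ioo 0 l, deriv η s • (z.fst + z'.fst : L2 l) s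
      = -∫ s in Ioo 0 l, η s • (z.snd + z'.snd : L2 l) s
    rw [k1, k2, hz η h1 h2 h3, hz' η h1 h2 h3, neg_add]
  smul_mem' := by
    intro c z hz η h1 h2 h3
    have key : ∀ (x : L2 l) (θ : ℝ → ℝ),
        ∫ s in Ioo 0 l, θ s • (c • x : L2 l) s = c • ∫ s in Ioo 0 l, θ s • x s := by
      intro x θ
      rw [← integral_smul]
      refine integral_congr_ae ?_
      filter_upwards [Lp.coeFn_smul c x] with s hs
      rw [hs, Pi.smul_apply, smul_comm]
    change ∫ s in Ioo 0 l, deriv η s • (c • z.fst : L2 l) s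
      = -∫ s in Ioo 0 l, η s • (c • z.snd : L2 l) s
    rw [key, key, hz η h1 h2 h3, smul_neg]

/-- `H¹(0, l; ℝ³)` as a normed space. -/
abbrev H1 (l : ℝ) : Type := H1Submodule l

/-- The function in `L²` underlying an element of `H¹`. -/
def H1.fn {l : ℝ} (v : H1 l) : L2 l := (v : WithLp 2 (L2 l × L2 l)).fst

/-- The (weak) derivative of an element of `H¹`. -/
def H1.deriv {l : ℝ} (v : H1 l) : L2 l := (v : WithLp 2 (L2 l × L2 l)).snd

/-- An element of `H¹` is a primitive of its weak derivative. -/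
theorem H1.exists_primitive {l : ℝ} (hl : 0 < l) (v : H1 l) :
    ∃ c : E3, ∀ᵐ s ∂strutMeasure l, v.fn s = c + ∫ t in (0 : ℝ)..s, v.deriv t := by
  have hcomp : ∀ (x : L2 l) (r : Fin 3),
      Integrable (fun s => x s r) (strutMeasure l) := fun x r =>
    (EuclideanSpace.proj r : E3 →L[ℝ] ℝ).integrable_comp x.integrable
  have hii : ∀ (x : L2 l) (r : Fin 3), IntervalIntegrable (fun s => x s r) volume 0 l :=
    fun x r => (intervalIntegrable_iff_integrableOn_Ioo_of_le hl.le).2 (hcomp x r)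
  have hproj : ∀ (x : L2 l) (θ : ℝ → ℝ), Continuous θ → HasCompactSupport θ → ∀ r : Fin 3,
      (∫ s in Ioo 0 l, θ s • x s) r = ∫ s in (0 : ℝ)..l, θ s * x s r := by
    intro x θ t1 t2 r
    rw [intervalIntegral.integral_of_le hl.le, integral_Ioc_eq_integral_Ioo]
    exact ((EuclideanSpace.proj r : E3 →L[ℝ] ℝ).integral_comp_comm
      (smul_L2_integrable x t1 t2)).symm
  have hr : ∀ r : Fin 3, ∃ c : ℝ, ∀ᵐ s, s ∈ Ioo 0 l →
      v.fn s r = c + ∫ t in (0 : ℝ)..s, v.deriv t r := by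
    intro r
    refine weakDeriv_scalar hl (hii _ r) (hii _ r) fun η h1 h2 h3 => ?_
    have e := congrArg (fun y : E3 => y r) (v.2 η h1 h2 h3)
    change (∫ s in Ioo 0 l, _root_.deriv η s • v.fn s) r
      = (-∫ s in Ioo 0 l, η s • v.deriv s) r at e
    rw [PiLp.neg_apply, hproj _ _ (h1.continuous_deriv (by simp)) h2.deriv,
      hproj _ _ h1.continuous h2] at e
    exact e
  choose c hc using hr
  refine ⟨WithLp.toLp 2 c, ?_⟩
  rw [ae_restrict_iff' measurableSet_Ioo]
  filter_upwards [ae_all_iff.2 hc] with s hs hsm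
  ext r
  rw [hs r hsm, PiLp.add_apply]
  congr 1
  have hi : IntervalIntegrable (fun t => v.deriv t) volume 0 s := by
    rw [intervalIntegrable_iff_integrableOn_Ioo_of_le hsm.1.le]
    exact IntegrableOn.mono_set v.deriv.integrable (Ioo_subset_Ioo_right hsm.2.le)
  exact (EuclideanSpace.proj r : E3 →L[ℝ] ℝ).intervalIntegral_comp_comm hi

/-- Every element of `H¹(0, l; ℝ³)` has a representative that is continuous on `[0, l]`. -/
theorem H1.exists_continuous_rep {l : ℝ} (v : H1 l) :
    ∃ u : ℝ → E3, ContinuousOn u (Icc 0 l) ∧ v.fn =ᵐ[strutMeasure l] u := by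
  rcases le_or_gt l 0 with hl | hl
  · refine ⟨0, continuousOn_const, ?_⟩
    rw [Filter.EventuallyEq, ae_restrict_iff' measurableSet_Ioo, Ioo_eq_empty_of_le hl]
    simp
  · obtain ⟨c, hc⟩ := v.exists_primitive hl
    refine ⟨fun s => c + ∫ t in (0 : ℝ)..s, v.deriv t, ?_, hc⟩
    refine continuousOn_const.add ?_
    rw [← uIcc_of_le hl.le]
    refine intervalIntegral.continuousOn_primitive_interval ?_
    rw [uIcc_of_le hl.le, integrableOn_Icc_iff_integrableOn_Ioo]
    exact v.deriv.integrable

/-- The continuous representative of an element of `H¹(0, l; ℝ³)`. Its values on `[0, l]` are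
uniquely determined when `l > 0`; in particular `v.rep 0` and `v.rep l` are the traces. -/
def H1.rep {l : ℝ} (v : H1 l) : ℝ → E3 := v.exists_continuous_rep.choose

/-- `x` coincides a.e. on `(0, l)` with a polynomial of degree at most `m` (componentwise). -/
def IsEdgePoly (m : ℕ) {l : ℝ} (x : L2 l) : Prop :=
  ∃ P : Fin 3 → Polynomial ℝ, (∀ r, (P r).natDegree ≤ m) ∧
    ∀ᵐ s ∂strutMeasure l, ∀ r, x s r = (P r).eval s

/-! ### The network of rods -/

/-- A stent: a finite connected oriented graph without loops and with at least one edge, whose edge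
`i` is a rod of length `len i` with middle curve `curve i`, cross-sectional frame `frame i` and
material and cross-section constants. The edge `i` leaves the vertex `src i` and enters
`tgt i`. -/
structure Stent where
  /-- number of vertices -/
  nV : ℕ
  /-- number of edges -/
  nE : ℕ
  src : Fin nE → Fin nV
  tgt : Fin nE → Fin nV
  src_ne_tgt : ∀ i, src i ≠ tgt i
  nE_pos : 0 < nE
  connected : (SimpleGraph.fromRel fun j j' => ∃ i, src i = j ∧ tgt i = j').Connected
  /-- positions of the vertices in space -/
  pos : Fin nV → E3
  /-- lengths of the struts -/
  len : Fin nE → ℝ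
  len_pos : ∀ i, 0 < len i
  /-- arc-length parametrizations of the middle curves -/
  curve : Fin nE → ℝ → E3
  curve_contDiff : ∀ i, ContDiffOn ℝ 1 (curve i) (Icc 0 (len i))
  curve_unit : ∀ i, ∀ s ∈ Icc 0 (len i), ‖derivWithin (curve i) (Icc 0 (len i)) s‖ = 1
  curve_zero : ∀ i, curve i 0 = pos (src i)
  curve_len : ∀ i, curve i (len i) = pos (tgt i)
  /-- the rotation matrices `Q = [t, n, b]` along the struts -/
  frame : Fin nE → ℝ → Matrix (Fin 3) (Fin 3) ℝ
  frame_measurable : ∀ i r r', AEMeasurable (fun s => frame i s r r') (strutMeasure (len i))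
  frame_rotation : ∀ i, ∀ s ∈ Icc 0 (len i),
    frame i s ∈ Matrix.specialOrthogonalGroup (Fin 3) ℝ
  frame_tangent : ∀ i, ∀ s ∈ Icc 0 (len i), ∀ r,
    frame i s r 0 = derivWithin (curve i) (Icc 0 (len i)) s r
  /-- shear moduli -/
  shear : Fin nE → ℝ
  /-- Young moduli -/
  young : Fin nE → ℝ
  /-- torsion constants `K` of the cross-sections -/
  torsion : Fin nE → ℝ
  /-- moments of inertia `I_n` of the cross-sections -/
  inertiaN : Fin nE → ℝ
  /-- moments of inertia `I_b` of the cross-sections -/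
  inertiaB : Fin nE → ℝ
  shear_pos : ∀ i, 0 < shear i
  young_pos : ∀ i, 0 < young i
  torsion_pos : ∀ i, 0 < torsion i
  inertiaN_pos : ∀ i, 0 < inertiaN i
  inertiaB_pos : ∀ i, 0 < inertiaB i

namespace Stent

variable (N : Stent)

/-- The unit tangent `t = curve'` of the `i`-th middle curve. -/
def tangent (i : Fin N.nE) (s : ℝ) : E3 := derivWithin (N.curve i) (Icc 0 (N.len i)) s

/-- `H = diag(μ K, E I_n, E I_b)`. -/
def elasticity (i : Fin N.nE) : Matrix (Fin 3) (Fin 3) ℝ :=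
  Matrix.diagonal ![N.shear i * N.torsion i, N.young i * N.inertiaN i, N.young i * N.inertiaB i]

/-- The compliance matrix `Q H⁻¹ Qᵀ`. -/
def compliance (i : Fin N.nE) (s : ℝ) : Matrix (Fin 3) (Fin 3) ℝ :=
  N.frame i s * (N.elasticity i)⁻¹ * (N.frame i s).transpose

/-- The `i`-th strut is straight. -/
def IsStraight (i : Fin N.nE) : Prop :=
  ∀ s ∈ Icc 0 (N.len i), N.len i • N.tangent i s = N.curve i (N.len i) - N.curve i 0

open Classical in
/-- The geometric condition on the network: axial forces on the straight edges that are balanced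
at every vertex vanish. -/
def GeometryCondition : Prop :=
  ∀ α : Fin N.nE → ℝ,
    (∀ j : Fin N.nV,
      (∑ i with N.tgt i = j ∧ N.IsStraight i, α i • N.tangent i 0)
        - (∑ i with N.src i = j ∧ N.IsStraight i, α i • N.tangent i 0) = 0) →
    ∀ i, N.IsStraight i → α i = 0

/-- `L²(𝒩; ℝ³)`. -/
abbrev L2Net : Type := PiLp 2 fun i : Fin N.nE => L2 (N.len i)

/-- `L²_{H¹}(𝒩; ℝ³)`, without continuity conditions at the vertices. -/
abbrev H1Net : Type := PiLp 2 fun i : Fin N.nE => H1 (N.len i)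

/-- `ℝ^{3 n_E}`: one vector of `ℝ³` per edge. -/
abbrev EdgeVec : Type := PiLp 2 fun _ : Fin N.nE => E3

/-- `ℝ^{3 n_V}`: one vector of `ℝ³` per vertex. -/
abbrev VertexVec : Type := PiLp 2 fun _ : Fin N.nV => E3

/-- The space `V` of tuples `(q, p, P₊, P₋, Q₊, Q₋, α, β)`, with the Hilbert product norm. -/
abbrev V : Type :=
  WithLp 2 (N.L2Net × WithLp 2 (N.L2Net × WithLp 2 (N.EdgeVec × WithLp 2 (N.EdgeVec ×
    WithLp 2 (N.EdgeVec × WithLp 2 (N.EdgeVec × WithLp 2 (E3 × E3)))))))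

/-- The space `M` of tuples `(u, ω, U, Ω)`, with the Hilbert product norm. -/
abbrev M : Type :=
  WithLp 2 (N.H1Net × WithLp 2 (N.H1Net × WithLp 2 (N.VertexVec × N.VertexVec)))

variable {N}

/-- contact moments `q` -/
def V.q (S : N.V) : N.L2Net := S.fst
/-- contact forces `p` -/
def V.p (S : N.V) : N.L2Net := S.snd.fst
/-- contact forces `P₊` at the ends of the struts -/
def V.Pp (S : N.V) : N.EdgeVec := S.snd.snd.fst
/-- contact forces `P₋` at the beginnings of the struts -/
def V.Pm (S : N.V) : N.EdgeVec := S.snd.snd.snd.fst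
/-- contact moments `Q₊` at the ends of the struts -/
def V.Qp (S : N.V) : N.EdgeVec := S.snd.snd.snd.snd.fst
/-- contact moments `Q₋` at the beginnings of the struts -/
def V.Qm (S : N.V) : N.EdgeVec := S.snd.snd.snd.snd.snd.fst
/-- multiplier `α` of the condition on the total displacement -/
def V.α (S : N.V) : E3 := S.snd.snd.snd.snd.snd.snd.fst
/-- multiplier `β` of the condition on the total rotation -/
def V.β (S : N.V) : E3 := S.snd.snd.snd.snd.snd.snd.snd

/-- displacements `u` of the struts -/
def M.u (φ : N.M) : N.H1Net := φ.fst
/-- infinitesimal rotations `ω` of the struts -/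
def M.ω (φ : N.M) : N.H1Net := φ.snd.fst
/-- displacements `U` of the vertices -/
def M.U (φ : N.M) : N.VertexVec := φ.snd.snd.fst
/-- infinitesimal rotations `Ω` of the vertices -/
def M.Ω (φ : N.M) : N.VertexVec := φ.snd.snd.snd

/-- The incidence matrix `A⁺` applied to `P`: at each vertex, the sum over the edges entering it. -/
def incPlus (P : N.EdgeVec) : N.VertexVec :=
  WithLp.toLp 2 fun j => ∑ i with N.tgt i = j, P i

/-- The incidence matrix `A⁻` applied to `P`: at each vertex, the sum over the edges leaving it. -/
def incMinus (P : N.EdgeVec) : N.VertexVec :=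
  WithLp.toLp 2 fun j => ∑ i with N.src i = j, P i

/-- `∫_𝒩 v`, the sum of the integrals over all struts. -/
def netIntegral (v : N.H1Net) : E3 := ∑ i, ∫ s in Ioo 0 (N.len i), (v i).fn s

/-- The bilinear form `a`. -/
def a (S T : N.V) : ℝ :=
  ∑ i, ∫ s in Ioo 0 (N.len i),
    inner ℝ (Matrix.toEuclideanLin (N.compliance i s) (S.q i s)) (T.q i s)

/-- The bilinear form `b`. -/
def b (S : N.V) (ψ : N.M) : ℝ :=
  (∑ i, ∫ s in Ioo 0 (N.len i),
      (-inner ℝ (S.p i s) ((ψ.u i).deriv s + cross (N.tangent i s) ((ψ.ω i).fn s))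
        - inner ℝ (S.q i s) ((ψ.ω i).deriv s)))
    + (∑ i, (inner ℝ (S.Pp i) ((ψ.u i).rep (N.len i)) - inner ℝ (S.Pm i) ((ψ.u i).rep 0)))
    + (∑ i, (inner ℝ (S.Qp i) ((ψ.ω i).rep (N.len i)) - inner ℝ (S.Qm i) ((ψ.ω i).rep 0)))
    - inner ℝ (incPlus S.Pp - incMinus S.Pm) ψ.U
    - inner ℝ (incPlus S.Qp - incMinus S.Qm) ψ.Ω
    + inner ℝ S.α (netIntegral ψ.u) + inner ℝ S.β (netIntegral ψ.ω)

/-- The load functional `ψ = (v, w, V, W) ↦ -∑ ∫ f · v`. -/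
def load (f : N.L2Net) (ψ : N.M) : ℝ :=
  -∑ i, ∫ s in Ioo 0 (N.len i), inner ℝ (f i s) ((ψ.u i).fn s)

/-- `(S, φ)` solves the mixed variational problem with load density `f`. -/
def IsSolution (f : N.L2Net) (S : N.V) (φ : N.M) : Prop :=
  (∀ T : N.V, a S T + b T φ = 0) ∧ ∀ ψ : N.M, b S ψ = load f ψ

variable (N)

/-- `V_k`: `q` and `p` are polynomials of degree at most `k` on each edge. -/
def Vh (k : ℕ) : Set N.V := {S | ∀ i, IsEdgePoly k (S.q i) ∧ IsEdgePoly k (S.p i)}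

/-- `M_n`: `u` and `ω` are polynomials of degree at most `n` on each edge. -/
def Mh (n : ℕ) : Set N.M := {φ | ∀ i, IsEdgePoly n (φ.u i).fn ∧ IsEdgePoly n (φ.ω i).fn}

variable {N}

/-- `(S, φ) ∈ V_k × M_n` solves the discrete problem with load density `f`. -/
def IsDiscreteSolution (f : N.L2Net) (k n : ℕ) (S : N.V) (φ : N.M) : Prop :=
  S ∈ N.Vh k ∧ φ ∈ N.Mh n ∧
    (∀ T ∈ N.Vh k, a S T + b T φ = 0) ∧ ∀ ψ ∈ N.Mh n, b S ψ = load f ψ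

end Stent

end

noncomputable section

/-! ### The cross product -/

/-! The trial space $V_k\times M_n$ is one fixed finite-dimensional space, so no uniform inf-sup
estimate is needed: quasi-optimality follows once the homogeneous discrete problem has only the
trivial solution. Evaluating the mixed form against a basis is then injective on the trial space,
hence bounded below there, and Galerkin orthogonality does the rest (`exists_galerkin_bound`,
`exists_mixed_bound`). For this, $a$ and $b$ are represented by bounded operators `aOp` and `bOp`;
boundedness of `bOp` rests on the trace inequality in $H^1$.

Let $k\ge 1$ and let $(\Sigma,\varphi)$ solve the homogeneous problem. Testing with $\Sigma$ gives
$a(\Sigma,\Sigma)=0$, hence $q=0$, since the compliance is positive definite. What remains is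
$b(\cdot,\varphi)=0$ on $V_k$ and $b(\Sigma,\cdot)=0$ on $M_{k+1}$.

The first gives $\varphi=0$ (`eq_zero_of_forall_b_eq_zero`): rotations, and then displacements, are
constant on each edge, agree at the vertices and have mean zero on a connected graph. The second
gives $\Sigma=0$ (`eq_zero_of_q_eq_zero`): rigid motions kill the multipliers, suitable
displacements force $p=P_+=P_-$ to be constant on each edge, a quadratic bubble rotation forces $p$
to be axial, affine rotations kill the end moments, and the geometry condition excludes balanced
axial forces.

The bubble needs $2\le k+1$. This is why $k=0$ is special; there the assumed uniqueness supplies the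
statement by linearity. -/

theorem cross_apply_zero (x y : E3) : cross x y 0 = x 1 * y 2 - x 2 * y 1 := by
  simp [cross, crossProduct]

theorem cross_apply_one (x y : E3) : cross x y 1 = x 2 * y 0 - x 0 * y 2 := by
  simp [cross, crossProduct]

theorem cross_apply_two (x y : E3) : cross x y 2 = x 0 * y 1 - x 1 * y 0 := by
  simp [cross, crossProduct]

theorem inner_cross_cycle (x y z : E3) : inner ℝ x (cross y z) = inner ℝ (cross x y) z := by
  simp only [PiLp.inner_apply, Fin.sum_univ_three, cross_apply_zero, cross_apply_one,
    cross_apply_two, RCLike.inner_apply, conj_trivial]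
  ring

/-- Applied to a unit vector $t$: if $p\times t=0$, then $p$ equals its axial component $(t\cdot
p)\,t$. -/
theorem cross_cross_self (p t : E3) :
    cross t (cross p t) = inner ℝ t t • p - inner ℝ t p • t := by
  have h (x y : E3) : inner ℝ x y = y 0 * x 0 + y 1 * x 1 + y 2 * x 2 := by
    simp [PiLp.inner_apply, Fin.sum_univ_three]
  rw [h, h]
  ext r
  fin_cases r <;>
    simp [cross_apply_zero, cross_apply_one, cross_apply_two] <;> ring

theorem cross_neg_comm (x y : E3) : cross x y = -cross y x := by
  ext r
  fin_cases r <;> simp [cross_apply_zero, cross_apply_one, cross_apply_two] <;> ring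

/-- The cross product with a fixed left factor. -/
def crossLeft (t : E3) : E3 →L[ℝ] E3 :=
  LinearMap.toContinuousLinearMap
    { toFun := cross t
      map_add' := fun x y => by simp [cross]
      map_smul' := fun c x => by simp [cross] }

@[simp] theorem crossLeft_apply (t x : E3) : crossLeft t x = cross t x := rfl

theorem cross_zero_right (t : E3) : cross t 0 = 0 := (crossLeft t).map_zero

/-! ### Square-integrable functions on a strut -/

variable {l : ℝ}

/-- The integral over the strut as a continuous linear map on `L²`. -/
def meanL (l : ℝ) : L2 l →L[ℝ] E3 :=
  (ContinuousLinearMap.lsmul ℝ ℝ : ℝ →L[ℝ] E3 →L[ℝ] E3).lpPairing (strutMeasure l) 2 2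
    (Lp.const 2 (strutMeasure l) (1 : ℝ))

theorem meanL_apply (x : L2 l) : meanL l x = ∫ s in Ioo 0 l, x s := by
  rw [meanL, ContinuousLinearMap.lpPairing_eq_integral]
  refine integral_congr_ae ?_
  filter_upwards [Lp.coeFn_const (p := 2) (μ := strutMeasure l) (c := (1 : ℝ))] with s hs
  rw [hs]
  simp

/-- The cross product with a constant vector on the left, acting on `L²`. -/
def crossL2 (l : ℝ) (t : E3) : L2 l →L[ℝ] L2 l := (crossLeft t).compLpL 2 (strutMeasure l)

theorem crossL2_coeFn (t : E3) (x : L2 l) :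
    crossL2 l t x =ᵐ[strutMeasure l] fun s => cross t (x s) :=
  (crossLeft t).coeFn_compLpL x

/-- Cauchy–Schwarz against the constant function $1$, whose $L^2$ norm is the constant $K$. -/
theorem norm_integral_norm_le (l : ℝ) : ∃ K : ℝ, 0 ≤ K ∧
    ∀ x : L2 l, ∫ s in Ioo 0 l, ‖x s‖ ≤ K * ‖x‖ := by
  refine ⟨‖Lp.const 2 (strutMeasure l) (1 : ℝ)‖, norm_nonneg _, fun x => ?_⟩
  have hx : MemLp (fun s => ‖x s‖) 2 (strutMeasure l) := (Lp.memLp x).norm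
  have h : ∫ s in Ioo 0 l, ‖x s‖
      = inner ℝ (Lp.const 2 (strutMeasure l) (1 : ℝ)) (hx.toLp _) := by
    rw [L2.inner_def]
    refine integral_congr_ae ?_
    filter_upwards [Lp.coeFn_const (p := 2) (μ := strutMeasure l) (c := (1 : ℝ)),
      hx.coeFn_toLp] with s h1 h2
    rw [h1, h2]
    simp
  rw [h]
  refine (real_inner_le_norm _ _).trans_eq ?_
  congr 1
  rw [Lp.norm_toLp, Lp.norm_def, eLpNorm_norm]

/-! ### Vectors of polynomials -/

/-- The value at `s` of a vector of polynomials. -/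
def evalV (P : Fin 3 → Polynomial ℝ) (s : ℝ) : E3 := WithLp.toLp 2 fun r => (P r).eval s

@[simp] theorem evalV_apply (P : Fin 3 → Polynomial ℝ) (s : ℝ) (r : Fin 3) :
    evalV P s r = (P r).eval s := rfl

theorem continuous_evalV (P : Fin 3 → Polynomial ℝ) : Continuous (evalV P) :=
  (PiLp.continuous_toLp 2 _).comp (continuous_pi fun r => (P r).continuous)

theorem hasDerivAt_evalV (P : Fin 3 → Polynomial ℝ) (s : ℝ) :
    HasDerivAt (evalV P) (evalV (fun r => (P r).derivative) s) s := by
  have h : HasDerivAt (fun s => fun r => (P r).eval s)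
      (fun r => (P r).derivative.eval s) s :=
    hasDerivAt_pi.2 fun r => (P r).hasDerivAt s
  exact ((PiLp.continuousLinearEquiv 2 ℝ (fun _ : Fin 3 => ℝ)).symm.toContinuousLinearMap
    |>.hasFDerivAt).comp_hasDerivAt s h

theorem memLp_of_continuous {f : ℝ → E3} (hf : Continuous f) :
    MemLp f 2 (strutMeasure l) := by
  obtain ⟨C, hC⟩ := (isCompact_Icc (a := 0) (b := l)).exists_bound_of_continuousOn hf.continuousOn
  refine MemLp.of_bound hf.aestronglyMeasurable C ?_
  rw [ae_restrict_iff' measurableSet_Ioo]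
  exact Filter.Eventually.of_forall fun s hs => hC s (Ioo_subset_Icc_self hs)

/-- A vector of polynomials as an element of `L²`. -/
def polyL2 (l : ℝ) (P : Fin 3 → Polynomial ℝ) : L2 l :=
  (memLp_of_continuous (continuous_evalV P)).toLp _

theorem polyL2_coeFn (P : Fin 3 → Polynomial ℝ) :
    polyL2 l P =ᵐ[strutMeasure l] evalV P := MemLp.coeFn_toLp _

theorem isEdgePoly_iff {m : ℕ} {x : L2 l} :
    IsEdgePoly m x ↔ ∃ P : Fin 3 → Polynomial ℝ, (∀ r, (P r).natDegree ≤ m) ∧ x = polyL2 l P := by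
  refine exists_congr fun P => and_congr_right fun _ => ⟨fun h => ?_, fun h => ?_⟩
  · refine Lp.ext ?_
    filter_upwards [h, polyL2_coeFn P] with s h1 h2
    rw [h2]
    ext r
    exact h1 r
  · filter_upwards [polyL2_coeFn (l := l) P] with s h2 r
    rw [h, h2, evalV_apply]

theorem polyL2_add (P Q : Fin 3 → Polynomial ℝ) :
    polyL2 l (P + Q) = polyL2 l P + polyL2 l Q := by
  refine Lp.ext ?_
  filter_upwards [polyL2_coeFn (l := l) (P + Q), polyL2_coeFn (l := l) P, polyL2_coeFn (l := l) Q,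
    Lp.coeFn_add (polyL2 l P) (polyL2 l Q)] with s h1 h2 h3 h4
  rw [h1, h4, Pi.add_apply, h2, h3]
  ext r
  simp

theorem polyL2_smul (c : ℝ) (P : Fin 3 → Polynomial ℝ) :
    polyL2 l (c • P) = c • polyL2 l P := by
  refine Lp.ext ?_
  filter_upwards [polyL2_coeFn (l := l) (c • P), polyL2_coeFn (l := l) P,
    Lp.coeFn_smul c (polyL2 l P)] with s h1 h2 h4
  rw [h1, h4, Pi.smul_apply, h2]
  ext r
  simp

/-- The polynomials of degree at most `m` as a subspace of `L²`. -/
def polySub (m : ℕ) (l : ℝ) : Submodule ℝ (L2 l) :=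
  LinearMap.range
    ({ toFun := fun P => polyL2 l fun r => (P r : Polynomial ℝ)
       map_add' := fun _ _ => polyL2_add _ _
       map_smul' := fun _ _ => polyL2_smul _ _ } :
      (Fin 3 → Polynomial.degreeLE ℝ m) →ₗ[ℝ] L2 l)

theorem mem_polySub {m : ℕ} {x : L2 l} : x ∈ polySub m l ↔ IsEdgePoly m x := by
  rw [isEdgePoly_iff]
  constructor
  · rintro ⟨P, rfl⟩
    exact ⟨fun r => P r, fun r => Polynomial.natDegree_le_iff_degree_le.2
      (Polynomial.mem_degreeLE.1 (P r).2), rfl⟩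
  · rintro ⟨P, hP, rfl⟩
    exact ⟨fun r => ⟨P r, Polynomial.mem_degreeLE.2
      (Polynomial.natDegree_le_iff_degree_le.1 (hP r))⟩, rfl⟩

instance (m : ℕ) : FiniteDimensional ℝ (Polynomial.degreeLE ℝ (m : WithBot ℕ)) := by
  rw [Polynomial.degreeLE_eq_span_X_pow]
  exact FiniteDimensional.span_finset ℝ _

instance (m : ℕ) (l : ℝ) : FiniteDimensional ℝ (polySub m l) := by
  unfold polySub
  infer_instance

/-- An antiderivative of a polynomial, vanishing at zero. -/
def polyPrimitive (p : Polynomial ℝ) : Polynomial ℝ :=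
  p.sum fun n c => Polynomial.monomial (n + 1) (c / (n + 1))

theorem derivative_polyPrimitive (p : Polynomial ℝ) : (polyPrimitive p).derivative = p := by
  rw [polyPrimitive, Polynomial.sum_def, Polynomial.derivative_sum]
  conv_rhs => rw [p.as_sum_support]
  refine Finset.sum_congr rfl fun n _ => ?_
  rw [Polynomial.derivative_monomial]
  congr 1
  push_cast
  field_simp

theorem polyPrimitive_eval_zero (p : Polynomial ℝ) : (polyPrimitive p).eval 0 = 0 := by
  rw [polyPrimitive, Polynomial.sum_def, Polynomial.eval_finsetSum]
  exact Finset.sum_eq_zero fun n _ => by simp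

theorem natDegree_polyPrimitive_le {p : Polynomial ℝ} {m : ℕ} (hp : p.natDegree ≤ m) :
    (polyPrimitive p).natDegree ≤ m + 1 := by
  rw [polyPrimitive, Polynomial.sum_def]
  refine Polynomial.natDegree_sum_le_of_forall_le _ _ fun n hn => ?_
  refine (Polynomial.natDegree_monomial_le _).trans ?_
  have := Polynomial.le_natDegree_of_mem_supp n hn
  omega

/-! ### `H¹` on a strut -/

theorem H1.fn_add (v w : H1 l) : (v + w).fn = v.fn + w.fn := rfl
theorem H1.fn_smul (c : ℝ) (v : H1 l) : (c • v).fn = c • v.fn := rfl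

/-- The embedding of `H¹` into `L²`. -/
def fnL (l : ℝ) : H1 l →L[ℝ] L2 l :=
  (WithLp.fstL 2 ℝ (L2 l) (L2 l)).comp (H1Submodule l).subtypeL

/-- The weak derivative as a continuous linear map. -/
def derivL (l : ℝ) : H1 l →L[ℝ] L2 l :=
  (WithLp.sndL 2 ℝ (L2 l) (L2 l)).comp (H1Submodule l).subtypeL

@[simp] theorem fnL_apply (v : H1 l) : fnL l v = v.fn := rfl

/-- The fundamental lemma of the calculus of variations: the derivative integrates to zero against
every test function. Consequently an element of $H^1$ is determined by its underlying function
alone. -/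
theorem H1.deriv_eq_zero {v : H1 l} (h : v.fn = 0) : v.deriv = 0 := by
  have hloc : LocallyIntegrableOn (fun s => v.deriv s) (Ioo 0 l) volume :=
    IntegrableOn.locallyIntegrableOn v.deriv.integrable
  have h0 : ∀ᵐ s, s ∈ Ioo 0 l → v.deriv s = 0 := by
    refine isOpen_Ioo.ae_eq_zero_of_integral_contDiff_smul_eq_zero hloc fun η h1 h2 h3 => ?_
    have hw : ∫ s in Ioo 0 l, _root_.deriv η s • v.fn s
      = -∫ s in Ioo 0 l, η s • v.deriv s := v.2 η h1 h2 h3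
    rw [← setIntegral_eq_integral_of_forall_compl_eq_zero (s := Ioo 0 l), ← neg_eq_zero, ← hw, h]
    · refine integral_eq_zero_of_ae ?_
      filter_upwards [Lp.coeFn_zero E3 2 (strutMeasure l)] with s hs
      rw [hs]
      simp
    · intro s hs
      rw [image_eq_zero_of_notMem_tsupport fun hx' => hs (h3 hx'), zero_smul]
  refine Lp.ext ?_
  rw [Filter.EventuallyEq, ae_restrict_iff' measurableSet_Ioo]
  have hz := Lp.coeFn_zero E3 2 (strutMeasure l)
  rw [Filter.EventuallyEq, ae_restrict_iff' measurableSet_Ioo] at hz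
  filter_upwards [h0, hz] with s h1 h2 hs
  rw [h1 hs, h2 hs, Pi.zero_apply]

theorem H1.ext_fn {v w : H1 l} (h : v.fn = w.fn) : v = w := by
  have h1 : (v - w).fn = 0 := by
    change fnL l (v - w) = 0
    rw [map_sub, fnL_apply, fnL_apply, h, sub_self]
  have h2 : derivL l (v - w) = 0 := H1.deriv_eq_zero h1
  rw [map_sub, sub_eq_zero] at h2
  refine Subtype.ext ((WithLp.equiv 2 _).injective (Prod.ext h h2))

theorem H1.rep_continuousOn (v : H1 l) : ContinuousOn v.rep (Icc 0 l) :=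
  v.exists_continuous_rep.choose_spec.1

theorem H1.fn_ae_eq_rep (v : H1 l) : v.fn =ᵐ[strutMeasure l] v.rep :=
  v.exists_continuous_rep.choose_spec.2

/-- `rep` comes from a choice. It can be computed from any continuous representative, because
continuous functions that agree almost everywhere on a nondegenerate interval agree everywhere. -/
theorem H1.rep_eqOn (hl : 0 < l) (v : H1 l) {u : ℝ → E3} (hu : ContinuousOn u (Icc 0 l))
    (h : v.fn =ᵐ[strutMeasure l] u) : EqOn v.rep u (Icc 0 l) := by
  refine Measure.eqOn_Icc_of_ae_eq volume hl.ne ?_ v.rep_continuousOn hu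
  rw [Filter.EventuallyEq, ← restrict_Ioo_eq_restrict_Icc]
  exact v.fn_ae_eq_rep.symm.trans h

theorem H1.primitive_continuousOn (hl : 0 < l) (x : L2 l) :
    ContinuousOn (fun s => ∫ t in (0 : ℝ)..s, x t) (Icc 0 l) := by
  rw [← uIcc_of_le hl.le]
  refine intervalIntegral.continuousOn_primitive_interval ?_
  rw [uIcc_of_le hl.le, integrableOn_Icc_iff_integrableOn_Ioo]
  exact x.integrable

theorem H1.rep_eq_primitive (hl : 0 < l) (v : H1 l) {s : ℝ} (hs : s ∈ Icc 0 l) :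
    v.rep s = v.rep 0 + ∫ t in (0 : ℝ)..s, v.deriv t := by
  obtain ⟨c, hc⟩ := v.exists_primitive hl
  have h := v.rep_eqOn hl (continuousOn_const.add (H1.primitive_continuousOn hl v.deriv)) hc
  have h0 := h (left_mem_Icc.2 hl.le)
  rw [Pi.add_apply, intervalIntegral.integral_same, add_zero] at h0
  rw [h hs, h0, Pi.add_apply]

theorem H1.rep_len (hl : 0 < l) (v : H1 l) : v.rep l = v.rep 0 + meanL l v.deriv := by
  rw [v.rep_eq_primitive hl (right_mem_Icc.2 hl.le), meanL_apply,
    intervalIntegral.integral_of_le hl.le, integral_Ioc_eq_integral_Ioo]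

/-- The trace inequality: bound $v(0)=v(s)-\int_0^s v'$ for almost every $s$ and integrate over
$s\in(0,l)$. Dividing by $l$ leaves the constant $K/l+K$. -/
theorem H1.norm_rep_zero_le (hl : 0 < l) : ∃ K : ℝ, ∀ v : H1 l, ‖v.rep 0‖ ≤ K * ‖v‖ := by
  obtain ⟨K, hK0, hK⟩ := norm_integral_norm_le l
  refine ⟨K / l + K, fun v => ?_⟩
  have h1 : ‖v.fn‖ ≤ ‖v‖ := WithLp.norm_fst_le _ (v : WithLp 2 (L2 l × L2 l))
  have h2 : ‖v.deriv‖ ≤ ‖v‖ := WithLp.norm_snd_le _ (v : WithLp 2 (L2 l × L2 l))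
  have hae : ∀ᵐ s ∂strutMeasure l, ‖v.rep 0‖ ≤ ‖v.fn s‖ + K * ‖v.deriv‖ := by
    filter_upwards [v.fn_ae_eq_rep, ae_restrict_mem measurableSet_Ioo] with s hs hsm
    have e := v.rep_eq_primitive hl (Ioo_subset_Icc_self hsm)
    have : v.rep 0 = v.fn s - ∫ t in (0 : ℝ)..s, v.deriv t := by rw [hs, e]; abel
    rw [this]
    refine (norm_sub_le _ _).trans (add_le_add_right ?_ _)
    refine (intervalIntegral.norm_integral_le_integral_norm hsm.1.le).trans ?_
    rw [intervalIntegral.integral_of_le hsm.1.le, integral_Ioc_eq_integral_Ioo]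
    refine le_trans ?_ (hK _)
    exact setIntegral_mono_set v.deriv.integrable.norm
      (Filter.Eventually.of_forall fun _ => norm_nonneg _)
      (LE.le.eventuallyLE (Ioo_subset_Ioo_right hsm.2.le))
  have hint := integral_mono_ae (integrable_const _)
    (v.fn.integrable.norm.add (integrable_const _)) hae
  simp only [Pi.add_apply] at hint
  rw [integral_add v.fn.integrable.norm (integrable_const _)] at hint
  simp only [integral_const, measureReal_restrict_apply_univ, Real.volume_real_Ioo_of_le hl.le,
    sub_zero, smul_eq_mul] at hint
  have h3 := hK v.fn
  have h4 : l * ‖v.rep 0‖ ≤ K * ‖v‖ + l * (K * ‖v‖) := by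
    refine hint.trans (add_le_add (h3.trans ?_) ?_) <;> gcongr
  have h5 : l * ((K / l + K) * ‖v‖) = K * ‖v‖ + l * (K * ‖v‖) := by field_simp
  rw [← h5] at h4
  exact le_of_mul_le_mul_left h4 hl

theorem H1.rep_add (hl : 0 < l) (v w : H1 l) {s : ℝ} (hs : s ∈ Icc 0 l) :
    (v + w).rep s = v.rep s + w.rep s := by
  refine (v + w).rep_eqOn hl (v.rep_continuousOn.add w.rep_continuousOn) ?_ hs
  filter_upwards [v.fn_ae_eq_rep, w.fn_ae_eq_rep, Lp.coeFn_add v.fn w.fn] with s h1 h2 h3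
  rw [H1.fn_add, h3, Pi.add_apply, Pi.add_apply, h1, h2]

theorem H1.rep_smul (hl : 0 < l) (c : ℝ) (v : H1 l) {s : ℝ} (hs : s ∈ Icc 0 l) :
    (c • v).rep s = c • v.rep s := by
  refine (c • v).rep_eqOn hl (v.rep_continuousOn.const_smul c) ?_ hs
  filter_upwards [v.fn_ae_eq_rep, Lp.coeFn_smul c v.fn] with s h1 h3
  rw [H1.fn_smul, h3, Pi.smul_apply, Pi.smul_apply, h1]

/-- The trace at the beginning of the strut. -/
def traceZero (hl : 0 < l) : H1 l →L[ℝ] E3 :=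
  LinearMap.mkContinuousOfExistsBound
    { toFun := fun v => v.rep 0
      map_add' := fun v w => H1.rep_add hl v w (left_mem_Icc.2 hl.le)
      map_smul' := fun c v => H1.rep_smul hl c v (left_mem_Icc.2 hl.le) }
    (H1.norm_rep_zero_le hl)

/-- The trace at the end of the strut. -/
def traceLen (hl : 0 < l) : H1 l →L[ℝ] E3 := traceZero hl + (meanL l).comp (derivL l)

@[simp] theorem traceLen_apply (hl : 0 < l) (v : H1 l) : traceLen hl v = v.rep l :=
  (v.rep_len hl).symm

theorem isWeakDeriv_polyL2 (P : Fin 3 → Polynomial ℝ) :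
    IsWeakDeriv l (polyL2 l P) (polyL2 l fun r => (P r).derivative) := by
  intro η h1 h2 h3
  rcases le_or_gt l 0 with hl | hl
  · simp [Ioo_eq_empty_of_le hl]
  have e1 : ∫ s in Ioo 0 l, deriv η s • polyL2 l P s = ∫ s in (0 : ℝ)..l, deriv η s • evalV P s := by
    rw [intervalIntegral.integral_of_le hl.le, integral_Ioc_eq_integral_Ioo]
    refine integral_congr_ae ?_
    filter_upwards [polyL2_coeFn (l := l) P] with s hs
    rw [hs]
  have e2 : ∫ s in Ioo 0 l, η s • polyL2 l (fun r => (P r).derivative) s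
      = ∫ s in (0 : ℝ)..l, η s • evalV (fun r => (P r).derivative) s := by
    rw [intervalIntegral.integral_of_le hl.le, integral_Ioc_eq_integral_Ioo]
    refine integral_congr_ae ?_
    filter_upwards [polyL2_coeFn (l := l) fun r => (P r).derivative] with s hs
    rw [hs]
  have c1 : Continuous fun s => deriv η s • evalV P s :=
    (h1.continuous_deriv (by simp)).smul (continuous_evalV P)
  have c2 : Continuous fun s => η s • evalV (fun r => (P r).derivative) s :=
    h1.continuous.smul (continuous_evalV _)
  rw [e1, e2, eq_neg_iff_add_eq_zero, ← intervalIntegral.integral_add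
    (c1.intervalIntegrable _ _) (c2.intervalIntegrable _ _)]
  have hη0 : ∀ x, x ∉ Ioo 0 l → η x = 0 := fun x hx =>
    image_eq_zero_of_notMem_tsupport fun hx' => hx (h3 hx')
  -- The integrand is the derivative of $\eta P$, and $\eta$ vanishes at both ends.
  rw [intervalIntegral.integral_eq_sub_of_hasDerivAt (f := fun s => η s • evalV P s),
    hη0 0 (by simp), hη0 l (by simp)]
  · simp
  · intro s _
    have := (h1.differentiable (by simp) s).hasDerivAt.smul (hasDerivAt_evalV P s)
    rwa [add_comm] at this
  · exact (c1.add c2).intervalIntegrable _ _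

/-- A vector of polynomials as an element of `H¹`. -/
def polyH1 (l : ℝ) (P : Fin 3 → Polynomial ℝ) : H1 l :=
  ⟨WithLp.toLp 2 (polyL2 l P, polyL2 l fun r => (P r).derivative), isWeakDeriv_polyL2 P⟩

@[simp] theorem polyH1_deriv (P : Fin 3 → Polynomial ℝ) :
    (polyH1 l P).deriv = polyL2 l fun r => (P r).derivative := rfl

theorem polyH1_rep (hl : 0 < l) (P : Fin 3 → Polynomial ℝ) {s : ℝ} (hs : s ∈ Icc 0 l) :
    (polyH1 l P).rep s = evalV P s :=
  (polyH1 l P).rep_eqOn hl (continuous_evalV P).continuousOn (polyL2_coeFn P) hs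

/-! ### Hilbert products of continuous linear maps -/

section Products

variable {X A B : Type*} [NormedAddCommGroup X] [NormedSpace ℝ X]
  [NormedAddCommGroup A] [NormedSpace ℝ A] [NormedAddCommGroup B] [NormedSpace ℝ B]

/-- The pairing of two continuous linear maps into the Hilbert product. -/
def pairL (f : X →L[ℝ] A) (g : X →L[ℝ] B) : X →L[ℝ] WithLp 2 (A × B) :=
  (WithLp.prodContinuousLinearEquiv 2 ℝ A B).symm.toContinuousLinearMap.comp (f.prod g)

variable {ι : Type*} {C : ι → Type*} [∀ i, NormedAddCommGroup (C i)]
  [∀ i, NormedSpace ℝ (C i)]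

/-- A family of continuous linear maps as a map into the Hilbert product. -/
def familyL [Fintype ι] (f : ∀ i, X →L[ℝ] C i) : X →L[ℝ] PiLp 2 C :=
  (PiLp.continuousLinearEquiv 2 ℝ C).symm.toContinuousLinearMap.comp (ContinuousLinearMap.pi f)

end Products

namespace Stent

/-- The inner product of `V`. -/
abbrev innerV (N : Stent) : InnerProductSpace ℝ N.V := inferInstance

/-- The linear structure of `M`. -/
abbrev normedSpaceM (N : Stent) : NormedSpace ℝ N.M := inferInstance

attribute [local instance] innerV normedSpaceM

variable {N : Stent}

/-! ### Components -/

/-- The displacement of an edge. -/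
def uL (N : Stent) (i : Fin N.nE) : N.M →L[ℝ] H1 (N.len i) :=
  (PiLp.proj 2 (fun i => H1 (N.len i)) i).comp (WithLp.fstL 2 ℝ _ _)

/-- The rotation of an edge. -/
def ωL (N : Stent) (i : Fin N.nE) : N.M →L[ℝ] H1 (N.len i) :=
  (PiLp.proj 2 (fun i => H1 (N.len i)) i).comp
    ((WithLp.fstL 2 ℝ _ _).comp (WithLp.sndL 2 ℝ _ _))

/-- The displacement of a vertex. -/
def UL (N : Stent) (j : Fin N.nV) : N.M →L[ℝ] E3 :=
  (PiLp.proj 2 (fun _ => E3) j).comp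
    ((WithLp.fstL 2 ℝ _ _).comp ((WithLp.sndL 2 ℝ _ _).comp (WithLp.sndL 2 ℝ _ _)))

/-- The rotation of a vertex. -/
def ΩL (N : Stent) (j : Fin N.nV) : N.M →L[ℝ] E3 :=
  (PiLp.proj 2 (fun _ => E3) j).comp
    ((WithLp.sndL 2 ℝ _ _).comp ((WithLp.sndL 2 ℝ _ _).comp (WithLp.sndL 2 ℝ _ _)))

theorem V.ext {S T : N.V} (hq : ∀ i, S.q i = T.q i) (hp : ∀ i, S.p i = T.p i)
    (hPp : ∀ i, S.Pp i = T.Pp i) (hPm : ∀ i, S.Pm i = T.Pm i) (hQp : ∀ i, S.Qp i = T.Qp i)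
    (hQm : ∀ i, S.Qm i = T.Qm i) (hα : S.α = T.α) (hβ : S.β = T.β) : S = T :=
  WithLp.ofLp_injective 2 <| Prod.ext (PiLp.ext hq) <|
    WithLp.ofLp_injective 2 <| Prod.ext (PiLp.ext hp) <|
    WithLp.ofLp_injective 2 <| Prod.ext (PiLp.ext hPp) <|
    WithLp.ofLp_injective 2 <| Prod.ext (PiLp.ext hPm) <|
    WithLp.ofLp_injective 2 <| Prod.ext (PiLp.ext hQp) <|
    WithLp.ofLp_injective 2 <| Prod.ext (PiLp.ext hQm) <|
    WithLp.ofLp_injective 2 <| Prod.ext hα hβ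

theorem M.ext {φ ψ : N.M} (hu : ∀ i, φ.u i = ψ.u i) (hω : ∀ i, φ.ω i = ψ.ω i)
    (hU : ∀ j, φ.U j = ψ.U j) (hΩ : ∀ j, φ.Ω j = ψ.Ω j) : φ = ψ :=
  WithLp.ofLp_injective 2 <| Prod.ext (PiLp.ext hu) <|
    WithLp.ofLp_injective 2 <| Prod.ext (PiLp.ext hω) <|
    WithLp.ofLp_injective 2 <| Prod.ext (PiLp.ext hU) (PiLp.ext hΩ)

theorem inner_V (S T : N.V) : inner ℝ S T = ∑ i, (inner ℝ (S.q i) (T.q i)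
      + inner ℝ (S.p i) (T.p i) + inner ℝ (S.Pp i) (T.Pp i) + inner ℝ (S.Pm i) (T.Pm i)
      + inner ℝ (S.Qp i) (T.Qp i) + inner ℝ (S.Qm i) (T.Qm i))
    + inner ℝ S.α T.α + inner ℝ S.β T.β := by
  simp only [WithLp.prod_inner_apply, PiLp.inner_apply, Finset.sum_add_distrib, V.q, V.p, V.Pp,
    V.Pm, V.Qp, V.Qm, V.α, V.β]
  simp only [add_assoc]
  rfl

/-! ### The form `b` on straight networks -/

/-- The constant direction of a straight edge. -/
def dir (N : Stent) (i : Fin N.nE) : E3 := N.tangent i 0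

theorem inner_dir (i : Fin N.nE) : inner ℝ (N.dir i) (N.dir i) = (1 : ℝ) := by
  rw [real_inner_self_eq_norm_sq, dir, tangent,
    N.curve_unit i 0 (left_mem_Icc.2 (N.len_pos i).le), one_pow]

theorem tangent_eq_dir {i : Fin N.nE} (h : N.IsStraight i) {s : ℝ} (hs : s ∈ Icc 0 (N.len i)) :
    N.tangent i s = N.dir i := by
  have h1 := h s hs
  rw [← h 0 (left_mem_Icc.2 (N.len_pos i).le)] at h1
  exact smul_right_injective E3 (N.len_pos i).ne' h1

theorem len_smul_dir {i : Fin N.nE} (h : N.IsStraight i) :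
    N.len i • N.dir i = N.pos (N.tgt i) - N.pos (N.src i) := by
  rw [← N.curve_zero, ← N.curve_len]
  exact h 0 (left_mem_Icc.2 (N.len_pos i).le)

/-- Every edge enters exactly one vertex, so the sum over vertices regroups into a sum over edges:
the adjoint of $A^+$ sends $U$ to its values at the end vertices. -/
theorem inner_incPlus (P : N.EdgeVec) (U : N.VertexVec) :
    inner ℝ (incPlus P) U = ∑ i, inner ℝ (P i) (U (N.tgt i)) := by
  rw [PiLp.inner_apply]
  rw [← Finset.sum_fiberwise Finset.univ N.tgt]
  refine Finset.sum_congr rfl fun j _ => ?_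
  change inner ℝ (∑ i with N.tgt i = j, P i) (U j) = _
  rw [sum_inner]
  refine Finset.sum_congr rfl fun i hi => ?_
  rw [(Finset.mem_filter.1 hi).2]

theorem inner_incMinus (P : N.EdgeVec) (U : N.VertexVec) :
    inner ℝ (incMinus P) U = ∑ i, inner ℝ (P i) (U (N.src i)) := by
  rw [PiLp.inner_apply]
  rw [← Finset.sum_fiberwise Finset.univ N.src]
  refine Finset.sum_congr rfl fun j _ => ?_
  change inner ℝ (∑ i with N.src i = j, P i) (U j) = _
  rw [sum_inner]
  refine Finset.sum_congr rfl fun i hi => ?_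
  rw [(Finset.mem_filter.1 hi).2]

/-- On a straight network, `b` is a sum of contributions of the edges. -/
theorem b_eq_sum (hN : ∀ i, N.IsStraight i) (S : N.V) (ψ : N.M) :
    b S ψ = ∑ i, (-inner ℝ (S.p i) ((ψ.u i).deriv + crossL2 (N.len i) (N.dir i) (ψ.ω i).fn)
      - inner ℝ (S.q i) (ψ.ω i).deriv
      + (inner ℝ (S.Pp i) ((ψ.u i).rep (N.len i) - ψ.U (N.tgt i))
        - inner ℝ (S.Pm i) ((ψ.u i).rep 0 - ψ.U (N.src i)))
      + (inner ℝ (S.Qp i) ((ψ.ω i).rep (N.len i) - ψ.Ω (N.tgt i))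
        - inner ℝ (S.Qm i) ((ψ.ω i).rep 0 - ψ.Ω (N.src i)))
      + inner ℝ S.α (meanL _ (ψ.u i).fn) + inner ℝ S.β (meanL _ (ψ.ω i).fn)) := by
  have h1 (i : Fin N.nE) : ∫ s in Ioo 0 (N.len i),
      (-inner ℝ (S.p i s) ((ψ.u i).deriv s + cross (N.tangent i s) ((ψ.ω i).fn s))
        - inner ℝ (S.q i s) ((ψ.ω i).deriv s))
      = -inner ℝ (S.p i) ((ψ.u i).deriv + crossL2 (N.len i) (N.dir i) (ψ.ω i).fn)
        - inner ℝ (S.q i) (ψ.ω i).deriv := by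
    rw [L2.inner_def, L2.inner_def, ← integral_neg, ← integral_sub]
    · refine integral_congr_ae ?_
      filter_upwards [ae_restrict_mem measurableSet_Ioo,
        crossL2_coeFn (N.dir i) (ψ.ω i).fn,
        Lp.coeFn_add (ψ.u i).deriv (crossL2 (N.len i) (N.dir i) (ψ.ω i).fn)] with s hs h2 h3
      rw [h3, Pi.add_apply, h2, tangent_eq_dir (hN i) (Ioo_subset_Icc_self hs)]
    · exact (L2.integrable_inner _ _).neg
    · exact L2.integrable_inner _ _
  simp only [b, h1, inner_sub_left, inner_incPlus, inner_incMinus, netIntegral, ← meanL_apply,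
    inner_sum, inner_sub_right, Finset.sum_add_distrib, Finset.sum_sub_distrib]
  ring

/-- The operator representing `b` by the inner product of `V`. -/
def bOp (N : Stent) : N.M →L[ℝ] N.V :=
  pairL (familyL fun i => -(derivL _).comp (N.ωL i)) <|
  pairL (familyL fun i => -((derivL _).comp (N.uL i)
    + (crossL2 (N.len i) (N.dir i)).comp ((fnL _).comp (N.ωL i)))) <|
  pairL (familyL fun i => (traceLen (N.len_pos i)).comp (N.uL i) - N.UL (N.tgt i)) <|
  pairL (familyL fun i => -((traceZero (N.len_pos i)).comp (N.uL i) - N.UL (N.src i))) <|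
  pairL (familyL fun i => (traceLen (N.len_pos i)).comp (N.ωL i) - N.ΩL (N.tgt i)) <|
  pairL (familyL fun i => -((traceZero (N.len_pos i)).comp (N.ωL i) - N.ΩL (N.src i))) <|
  pairL (∑ i, (meanL _).comp ((fnL _).comp (N.uL i)))
    (∑ i, (meanL _).comp ((fnL _).comp (N.ωL i)))

theorem bOp_q (ψ : N.M) (i : Fin N.nE) : (N.bOp ψ).q i = -(ψ.ω i).deriv := rfl

theorem bOp_p (ψ : N.M) (i : Fin N.nE) : (N.bOp ψ).p i
    = -((ψ.u i).deriv + crossL2 (N.len i) (N.dir i) (ψ.ω i).fn) := rfl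

theorem bOp_Pp (ψ : N.M) (i : Fin N.nE) :
    (N.bOp ψ).Pp i = (ψ.u i).rep (N.len i) - ψ.U (N.tgt i) := by
  rw [← traceLen_apply (N.len_pos i)]
  rfl

theorem bOp_Pm (ψ : N.M) (i : Fin N.nE) :
    (N.bOp ψ).Pm i = -((ψ.u i).rep 0 - ψ.U (N.src i)) := rfl

theorem bOp_Qp (ψ : N.M) (i : Fin N.nE) :
    (N.bOp ψ).Qp i = (ψ.ω i).rep (N.len i) - ψ.Ω (N.tgt i) := by
  rw [← traceLen_apply (N.len_pos i)]
  rfl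

theorem bOp_Qm (ψ : N.M) (i : Fin N.nE) :
    (N.bOp ψ).Qm i = -((ψ.ω i).rep 0 - ψ.Ω (N.src i)) := rfl

theorem bOp_α (ψ : N.M) : (N.bOp ψ).α = ∑ i, meanL _ (ψ.u i).fn := by
  change (∑ i, (meanL _).comp ((fnL _).comp (N.uL i))) ψ = _
  rw [_root_.sum_apply]
  rfl

theorem bOp_β (ψ : N.M) : (N.bOp ψ).β = ∑ i, meanL _ (ψ.ω i).fn := by
  change (∑ i, (meanL _).comp ((fnL _).comp (N.ωL i))) ψ = _
  rw [_root_.sum_apply]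
  rfl

theorem b_eq_inner (hN : ∀ i, N.IsStraight i) (S : N.V) (ψ : N.M) :
    b S ψ = inner ℝ (N.bOp ψ) S := by
  rw [b_eq_sum hN, real_inner_comm, inner_V]
  simp only [bOp_q, bOp_p, bOp_Pp, bOp_Pm, bOp_Qp, bOp_Qm, bOp_α, bOp_β, inner_sum, inner_neg_right,
    Finset.sum_add_distrib, Finset.sum_sub_distrib, Finset.sum_neg_distrib]
  ring

/-! ### The form `a` -/

theorem elasticity_inv (i : Fin N.nE) : (N.elasticity i)⁻¹.PosDef := by
  refine Matrix.PosDef.inv ?_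
  refine Matrix.PosDef.diagonal fun r => ?_
  fin_cases r
  · exact mul_pos (N.shear_pos i) (N.torsion_pos i)
  · exact mul_pos (N.young_pos i) (N.inertiaN_pos i)
  · exact mul_pos (N.young_pos i) (N.inertiaB_pos i)

/-- Congruence of the positive definite $H^{-1}$ by an invertible (orthogonal) matrix. -/
theorem compliance_posDef (i : Fin N.nE) {s : ℝ} (hs : s ∈ Icc 0 (N.len i)) :
    (N.compliance i s).PosDef := by
  have h : N.frame i s * (N.frame i s).transpose = 1 := (Matrix.mem_orthogonalGroup_iff (Fin 3) ℝ).1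
    (Matrix.mem_specialOrthogonalGroup_iff.1 (N.frame_rotation i s hs)).1
  have hinj : Function.Injective (N.frame i s).vecMul := by
    intro x y hxy
    have := congrArg (fun z => Matrix.vecMul z (N.frame i s).transpose) hxy
    simpa only [Matrix.vecMul_vecMul, h, Matrix.vecMul_one] using this
  have := (elasticity_inv i).mul_mul_conjTranspose_same hinj
  rwa [Matrix.conjTranspose_eq_transpose_of_trivial] at this

/-- The compliance as an operator on `ℝ³`. -/
def complianceAt (N : Stent) (i : Fin N.nE) (s : ℝ) : E3 →L[ℝ] E3 :=
  Matrix.toEuclideanCLM (𝕜 := ℝ) (N.compliance i s)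

theorem complianceAt_apply (i : Fin N.nE) (s : ℝ) (x : E3) :
    N.complianceAt i s x = Matrix.toEuclideanLin (N.compliance i s) x := rfl

theorem inner_complianceAt_pos (i : Fin N.nE) {s : ℝ} (hs : s ∈ Icc 0 (N.len i)) {x : E3}
    (hx : x ≠ 0) : 0 < inner ℝ (N.complianceAt i s x) x := by
  have := (N.compliance_posDef i hs).dotProduct_mulVec_pos (x := x.ofLp)
    (fun h => hx (WithLp.ofLp_injective 2 h))
  simpa [complianceAt_apply, EuclideanSpace.inner_eq_star_dotProduct] using this

/-- Entries of a rotation lie in $[-1,1]$, so the frames stay in a compact set of matrices, on which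
the continuous map $A\mapsto AH^{-1}A^T$ is bounded. Composition with this map also preserves
measurability. -/
theorem memLp_complianceAt (N : Stent) (i : Fin N.nE) :
    MemLp (N.complianceAt i) ⊤ (strutMeasure (N.len i)) := by
  have hF : Continuous fun A : Matrix (Fin 3) (Fin 3) ℝ =>
      (Matrix.toEuclideanCLM (𝕜 := ℝ) (A * (N.elasticity i)⁻¹ * A.transpose) : E3 →L[ℝ] E3) :=
    (LinearMap.continuous_of_finiteDimensional
      (Matrix.toEuclideanCLM (𝕜 := ℝ) (n := Fin 3)).toAlgEquiv.toLinearMap).comp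
        ((continuous_id.matrix_mul continuous_const).matrix_mul continuous_id.matrix_transpose)
  have hm : AEStronglyMeasurable (N.frame i) (strutMeasure (N.len i)) := by
    refine (aemeasurable_pi_lambda (X := fun _ => Fin 3 → ℝ) _ fun r =>
      aemeasurable_pi_lambda _ fun r' => ?_).aestronglyMeasurable
    exact N.frame_measurable i r r'
  have hc : IsCompact (Set.pi univ fun _ : Fin 3 => Set.pi univ fun _ : Fin 3 => Icc (-1 : ℝ) 1) :=
    isCompact_univ_pi fun _ => isCompact_univ_pi fun _ => isCompact_Icc
  obtain ⟨C, hC⟩ := hc.exists_bound_of_continuousOn hF.continuousOn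
  refine memLp_top_of_bound (hF.comp_aestronglyMeasurable hm) C ?_
  filter_upwards [ae_restrict_mem measurableSet_Ioo] with s hs
  refine hC (N.frame i s) fun r _ r' _ => abs_le.1 ?_
  exact entry_norm_bound_of_unitary
    (Matrix.mem_specialOrthogonalGroup_iff.1 (N.frame_rotation i s (Ioo_subset_Icc_self hs))).1 r r'

/-- The compliance as an operator on `L²`. -/
def complianceL (N : Stent) (i : Fin N.nE) : L2 (N.len i) →L[ℝ] L2 (N.len i) :=
  (ContinuousLinearMap.id ℝ (E3 →L[ℝ] E3)).holderL (strutMeasure (N.len i)) ⊤ 2 2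
    ((N.memLp_complianceAt i).toLp _)

theorem complianceL_coeFn (i : Fin N.nE) (x : L2 (N.len i)) :
    N.complianceL i x =ᵐ[strutMeasure (N.len i)] fun s => N.complianceAt i s (x s) := by
  filter_upwards [(ContinuousLinearMap.id ℝ (E3 →L[ℝ] E3)).coeFn_holder (r := 2)
    ((N.memLp_complianceAt i).toLp _) x, (N.memLp_complianceAt i).coeFn_toLp] with s h1 h2
  refine h1.trans ?_
  rw [h2]
  rfl

/-- Pointwise definiteness suffices; no coercivity constant enters. The hypothesis is $\le 0$ rather
than $=0$, so that nonnegativity of the form can be read off as well. -/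
theorem eq_zero_of_inner_complianceL {i : Fin N.nE} {x : L2 (N.len i)}
    (h : inner ℝ (N.complianceL i x) x ≤ 0) : x = 0 := by
  have hnn : ∀ᵐ s ∂strutMeasure (N.len i), 0 ≤ inner ℝ (N.complianceL i x s) (x s) := by
    filter_upwards [complianceL_coeFn i x, ae_restrict_mem measurableSet_Ioo] with s h1 hs
    rw [h1]
    by_cases hx : x s = 0
    · simp [hx]
    · exact (inner_complianceAt_pos i (Ioo_subset_Icc_self hs) hx).le
  rw [L2.inner_def] at h
  have h0 := (integral_eq_zero_iff_of_nonneg_ae hnn (L2.integrable_inner _ _)).1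
    (le_antisymm h (integral_nonneg_of_ae hnn))
  refine Lp.ext ?_
  filter_upwards [h0, complianceL_coeFn i x, ae_restrict_mem measurableSet_Ioo,
    Lp.coeFn_zero E3 2 (strutMeasure (N.len i))] with s h2 h1 hs h3
  rw [h3, Pi.zero_apply]
  by_contra hx
  have := inner_complianceAt_pos i (Ioo_subset_Icc_self hs) hx
  rw [← h1] at this
  exact this.ne' h2

/-- The operator representing `a` by the inner product of `V`. -/
def aOp (N : Stent) : N.V →L[ℝ] N.V :=
  pairL (familyL fun i => (N.complianceL i).comp
    ((PiLp.proj 2 (fun i => L2 (N.len i)) i).comp (WithLp.fstL 2 ℝ _ _))) 0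

theorem inner_aOp (S T : N.V) :
    inner ℝ (N.aOp S) T = ∑ i, inner ℝ (N.complianceL i (S.q i)) (T.q i) := by
  rw [WithLp.prod_inner_apply]
  change inner ℝ (N.aOp S).fst T.fst + inner ℝ 0 _ = _
  rw [inner_zero_left, add_zero, PiLp.inner_apply]
  rfl

theorem a_eq_inner (S T : N.V) : a S T = inner ℝ (N.aOp S) T := by
  rw [inner_aOp, a]
  refine Finset.sum_congr rfl fun i _ => ?_
  rw [L2.inner_def]
  refine integral_congr_ae ?_
  filter_upwards [complianceL_coeFn i (S.q i)] with s h1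
  rw [h1, complianceAt_apply]

theorem q_eq_zero_of_a_eq_zero {S : N.V} (h : a S S = 0) (i : Fin N.nE) : S.q i = 0 := by
  rw [a_eq_inner, inner_aOp] at h
  by_contra hi
  have hnn : ∀ i, 0 ≤ inner ℝ (N.complianceL i (S.q i)) (S.q i) := fun i => by
    by_contra hlt
    push Not at hlt
    rw [eq_zero_of_inner_complianceL hlt.le] at hlt
    simp at hlt
  exact hi (eq_zero_of_inner_complianceL
    ((Finset.sum_eq_zero_iff_of_nonneg fun i _ => hnn i).1 h i (Finset.mem_univ i)).le)

theorem a_eq_zero_of_q {S : N.V} (h : ∀ i, S.q i = 0) (T : N.V) : a S T = 0 := by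
  rw [a_eq_inner, inner_aOp]
  exact Finset.sum_eq_zero fun i _ => by rw [h, map_zero, inner_zero_left]

end Stent

/-! ### Constant, affine and bubble functions -/

section Polynomials

open Polynomial

/-- A constant vector of polynomials. -/
def constPoly (c : E3) : Fin 3 → ℝ[X] := fun r => C (c r)

/-- The affine function `s ↦ c + s d`. -/
def affinePoly (c d : E3) : Fin 3 → ℝ[X] := fun r => C (c r) + C (d r) * X

/-- The function `s ↦ s (l - s) g`. -/
def bubblePoly (l : ℝ) (g : E3) : Fin 3 → ℝ[X] := fun r => C (g r) * (X * (C l - X))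

theorem evalV_constPoly (c : E3) (s : ℝ) : evalV (constPoly c) s = c := by
  ext r
  simp [constPoly]

theorem evalV_affinePoly (c d : E3) (s : ℝ) : evalV (affinePoly c d) s = c + s • d := by
  ext r
  simp [affinePoly, mul_comm (d r)]

theorem evalV_bubblePoly (l : ℝ) (g : E3) (s : ℝ) :
    evalV (bubblePoly l g) s = (s * (l - s)) • g := by
  ext r
  simp [bubblePoly, mul_comm]

theorem derivative_affinePoly (c d : E3) :
    (fun r => (affinePoly c d r).derivative) = constPoly d := by
  ext1 r
  simp [affinePoly, constPoly]

theorem affinePoly_zero (c : E3) : affinePoly c 0 = constPoly c := by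
  ext1 r
  simp [affinePoly, constPoly]

theorem natDegree_constPoly_le (c : E3) (r : Fin 3) (m : ℕ) : (constPoly c r).natDegree ≤ m := by
  simp [constPoly]

theorem natDegree_affinePoly_le (c d : E3) (r : Fin 3) : (affinePoly c d r).natDegree ≤ 1 := by
  unfold affinePoly
  compute_degree

theorem natDegree_bubblePoly_le (l : ℝ) (g : E3) (r : Fin 3) :
    (bubblePoly l g r).natDegree ≤ 2 := by
  unfold bubblePoly
  compute_degree

theorem polyL2_constPoly_coeFn (c : E3) :
    polyL2 l (constPoly c) =ᵐ[strutMeasure l] fun _ => c := by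
  filter_upwards [polyL2_coeFn (l := l) (constPoly c)] with s hs
  rw [hs, evalV_constPoly]

theorem polyL2_zero : polyL2 l 0 = 0 := by
  simpa using polyL2_smul (l := l) 0 0

theorem constPoly_zero : constPoly 0 = 0 := by
  ext1 r
  simp [constPoly]

theorem inner_constPoly (c : E3) (x : L2 l) :
    inner ℝ (polyL2 l (constPoly c)) x = inner ℝ c (meanL l x) := by
  rw [meanL_apply, ← integral_inner x.integrable, L2.inner_def]
  refine integral_congr_ae ?_
  filter_upwards [polyL2_constPoly_coeFn c] with s hs
  rw [hs]

theorem crossL2_constPoly (t c : E3) :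
    crossL2 l t (polyL2 l (constPoly c)) = polyL2 l (constPoly (cross t c)) := by
  refine Lp.ext ?_
  filter_upwards [crossL2_coeFn t (polyL2 l (constPoly c)), polyL2_constPoly_coeFn (l := l) c,
    polyL2_constPoly_coeFn (l := l) (cross t c)] with s h1 h2 h3
  rw [h1, h2, h3]

theorem meanL_crossL2 (t : E3) (x : L2 l) : meanL l (crossL2 l t x) = cross t (meanL l x) := by
  rw [meanL_apply, meanL_apply, ← crossLeft_apply, ← (crossLeft t).integral_comp_comm x.integrable]
  refine integral_congr_ae ?_
  filter_upwards [crossL2_coeFn t x] with s h1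
  rw [h1, crossLeft_apply]

theorem meanL_constPoly (hl : 0 < l) (c : E3) : meanL l (polyL2 l (constPoly c)) = l • c := by
  rw [meanL_apply, integral_congr_ae (polyL2_constPoly_coeFn c)]
  simp [hl.le]

theorem meanL_bubblePoly (hl : 0 < l) (g : E3) :
    meanL l (polyL2 l (bubblePoly l g)) = (l ^ 3 / 6) • g := by
  have h : ∫ s in Ioo 0 l, polyL2 l (bubblePoly l g) s
      = ∫ s in (0 : ℝ)..l, (s * (l - s)) • g := by
    rw [intervalIntegral.integral_of_le hl.le, integral_Ioc_eq_integral_Ioo]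
    refine integral_congr_ae ?_
    filter_upwards [polyL2_coeFn (l := l) (bubblePoly l g)] with s hs
    rw [hs, evalV_bubblePoly]
  rw [meanL_apply, h, intervalIntegral.integral_smul_const]
  congr 1
  have : ∀ s : ℝ, s * (l - s) = l * s - s ^ 2 := fun s => by ring
  simp only [this]
  rw [intervalIntegral.integral_sub ((by fun_prop : Continuous fun s : ℝ => l * s)
    |>.intervalIntegrable _ _) ((by fun_prop : Continuous fun s : ℝ => s ^ 2)
    |>.intervalIntegrable _ _), intervalIntegral.integral_const_mul, integral_id, integral_pow]
  norm_num
  ring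

theorem H1.fn_eq_const (hl : 0 < l) {v : H1 l} (h : v.deriv = 0) :
    v.fn = polyL2 l (constPoly (v.rep 0)) := by
  refine Lp.ext ?_
  have h0 : ∀ᵐ s ∂volume, s ∈ Ioo 0 l → v.deriv s = 0 := by
    rw [h, ← ae_restrict_iff' measurableSet_Ioo]
    exact Lp.coeFn_zero _ _ _
  filter_upwards [v.fn_ae_eq_rep, polyL2_constPoly_coeFn (l := l) (v.rep 0),
    ae_restrict_mem measurableSet_Ioo] with s h1 h2 hs
  rw [h1, h2, v.rep_eq_primitive hl (Ioo_subset_Icc_self hs), add_eq_left,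
    intervalIntegral.integral_of_le hs.1.le, integral_Ioc_eq_integral_Ioo]
  refine integral_eq_zero_of_ae ?_
  rw [Filter.EventuallyEq, ae_restrict_iff' measurableSet_Ioo]
  filter_upwards [h0] with t ht hts
  exact ht (Ioo_subset_Ioo_right hs.2.le hts)

/-- This is the matching of degrees behind $n=k+1$: derivatives of kinematic functions are
admissible static functions. -/
theorem H1.deriv_mem_polySub {k : ℕ} {v : H1 l} (h : IsEdgePoly (k + 1) v.fn) :
    v.deriv ∈ polySub k l := by
  obtain ⟨P, hP, hv⟩ := isEdgePoly_iff.1 h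
  have : v = polyH1 l P := H1.ext_fn hv
  rw [this, mem_polySub, isEdgePoly_iff]
  exact ⟨_, fun r => (natDegree_derivative_le _).trans (by have := hP r; omega), rfl⟩

theorem constPoly_mem_polySub (k : ℕ) (c : E3) : polyL2 l (constPoly c) ∈ polySub k l :=
  mem_polySub.2 (isEdgePoly_iff.2 ⟨_, fun r => natDegree_constPoly_le c r k, rfl⟩)

end Polynomials

namespace Stent

attribute [local instance] innerV normedSpaceM

variable {N : Stent}

/-! ### Injectivity in the kinematic variable -/

/-- Equality propagates along a walk, whose steps may traverse an edge in either direction. -/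
theorem eq_of_edges {A : Type*} {W : Fin N.nV → A} (h : ∀ i, W (N.src i) = W (N.tgt i))
    (j j' : Fin N.nV) : W j = W j' := by
  obtain ⟨p⟩ := N.connected.preconnected j j'
  induction p with
  | nil => rfl
  | cons hadj _ ih =>
    refine Eq.trans ?_ ih
    rcases (SimpleGraph.fromRel_adj _ _ _).1 hadj with ⟨_, ⟨i, rfl, rfl⟩ | ⟨i, rfl, rfl⟩⟩
    · exact h i
    · exact (h i).symm

theorem sum_len_pos (N : Stent) : 0 < ∑ i, N.len i :=
  Finset.sum_pos (fun i _ => N.len_pos i) ⟨⟨0, N.nE_pos⟩, Finset.mem_univ _⟩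

/-- A piecewise constant function that is continuous at the vertices and has mean zero vanishes. -/
theorem eq_zero_of_deriv_eq_zero (v : N.H1Net) (W : N.VertexVec) (hd : ∀ i, (v i).deriv = 0)
    (h0 : ∀ i, (v i).rep 0 = W (N.src i)) (hl : ∀ i, (v i).rep (N.len i) = W (N.tgt i))
    (hm : ∑ i, meanL _ (v i).fn = 0) : (∀ i, v i = 0) ∧ ∀ j, W j = 0 := by
  have hW := eq_of_edges (N := N) (W := fun j => W j) fun i => by
    rw [← h0, ← hl, H1.rep_len (N.len_pos i), hd, map_zero, add_zero]
  set w : E3 := W (N.src ⟨0, N.nE_pos⟩) with hw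
  have hf (i : Fin N.nE) : (v i).fn = polyL2 _ (constPoly w) := by
    rw [H1.fn_eq_const (N.len_pos i) (hd i), h0]
    exact congrArg _ (congrArg _ (hW _ _))
  have hsum : (∑ i, N.len i) • w = 0 := by
    rw [Finset.sum_smul, ← hm]
    exact Finset.sum_congr rfl fun i _ => by rw [hf, meanL_constPoly (N.len_pos i)]
  have hw0 : w = 0 := (smul_eq_zero.1 hsum).resolve_left N.sum_len_pos.ne'
  refine ⟨fun i => H1.ext_fn ?_, fun j => (hW j _).trans hw0⟩
  rw [hf, hw0, constPoly_zero, polyL2_zero]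
  rfl

/-- Rotations come first: the force component $u'+t\times\omega$ reduces to $u'$ only after
$\omega=0$ is known. -/
theorem eq_zero_of_bOp_eq_zero {φ : N.M} (h : N.bOp φ = 0) : φ = 0 := by
  have hω := eq_zero_of_deriv_eq_zero φ.ω φ.Ω
    (fun i => by
      have := bOp_q φ i
      rw [h] at this
      exact neg_eq_zero.1 this.symm)
    (fun i => by
      have := bOp_Qm φ i
      rw [h] at this
      exact sub_eq_zero.1 (neg_eq_zero.1 this.symm))
    (fun i => by
      have := bOp_Qp φ i
      rw [h] at this
      exact sub_eq_zero.1 this.symm)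
    (by
      have := bOp_β φ
      rw [h] at this
      exact this.symm)
  have hu := eq_zero_of_deriv_eq_zero φ.u φ.U
    (fun i => by
      have := bOp_p φ i
      rw [h, hω.1 i] at this
      have h0 : (0 : H1 (N.len i)).fn = 0 := rfl
      rw [h0, map_zero, add_zero] at this
      exact neg_eq_zero.1 this.symm)
    (fun i => by
      have := bOp_Pm φ i
      rw [h] at this
      exact sub_eq_zero.1 (neg_eq_zero.1 this.symm))
    (fun i => by
      have := bOp_Pp φ i
      rw [h] at this
      exact sub_eq_zero.1 this.symm)
    (by
      have := bOp_α φ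
      rw [h] at this
      exact this.symm)
  exact M.ext hu.1 hω.1 hu.2 hω.2

/-- One would test with `bOp φ` itself, but its component $t\times\omega$ may have degree $k+1$.
Testing first with its moment part gives $\omega'=0$; then $t\times\omega$ is constant, `bOp φ` lies
in $V_k$, and its norm vanishes. -/
theorem eq_zero_of_forall_b_eq_zero (hN : ∀ i, N.IsStraight i) {k : ℕ} {φ : N.M}
    (hφ : φ ∈ N.Mh (k + 1)) (h : ∀ T ∈ N.Vh k, b T φ = 0) : φ = 0 := by
  have h0 (i : Fin N.nE) : IsEdgePoly k (0 : L2 (N.len i)) := mem_polySub.1 (zero_mem _)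
  have hq : ∀ i, (N.bOp φ).q i = 0 := by
    have hmem : (WithLp.toLp 2 ((N.bOp φ).q, 0) : N.V) ∈ N.Vh k := fun i =>
      ⟨mem_polySub.1 (neg_mem (H1.deriv_mem_polySub (hφ i).2)), h0 i⟩
    have hb := h _ hmem
    rw [b_eq_inner hN, WithLp.prod_inner_apply] at hb
    change inner ℝ (N.bOp φ).q (N.bOp φ).q + inner ℝ _ 0 = (0 : ℝ) at hb
    rw [inner_zero_right, add_zero, inner_self_eq_zero] at hb
    intro i
    rw [hb]
    rfl
  have hmem : N.bOp φ ∈ N.Vh k := by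
    intro i
    refine ⟨by rw [hq]; exact h0 i, mem_polySub.1 (neg_mem (add_mem
      (H1.deriv_mem_polySub (hφ i).1) ?_))⟩
    change crossL2 (N.len i) (N.dir i) (φ.ω i).fn ∈ _
    rw [H1.fn_eq_const (N.len_pos i) (neg_eq_zero.1 ((bOp_q φ i).symm.trans (hq i))),
      crossL2_constPoly]
    exact constPoly_mem_polySub _ _
  have hb := h _ hmem
  rw [b_eq_inner hN, inner_self_eq_zero] at hb
  exact eq_zero_of_bOp_eq_zero hb

/-! ### Injectivity in the static variable -/

/-- The element of `M` with given polynomials on the edges. -/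
def polyM (N : Stent) (P Q : Fin N.nE → Fin 3 → Polynomial ℝ) (U Ω : Fin N.nV → E3) : N.M :=
  WithLp.toLp 2 (WithLp.toLp 2 fun i => polyH1 (N.len i) (P i),
    WithLp.toLp 2 (WithLp.toLp 2 fun i => polyH1 (N.len i) (Q i),
      WithLp.toLp 2 (WithLp.toLp 2 U, WithLp.toLp 2 Ω)))

theorem polyM_mem {P Q : Fin N.nE → Fin 3 → Polynomial ℝ} {U Ω : Fin N.nV → E3} {n : ℕ}
    (hP : ∀ i r, (P i r).natDegree ≤ n) (hQ : ∀ i r, (Q i r).natDegree ≤ n) :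
    N.polyM P Q U Ω ∈ N.Mh n := fun i =>
  ⟨isEdgePoly_iff.2 ⟨P i, hP i, rfl⟩, isEdgePoly_iff.2 ⟨Q i, hQ i, rfl⟩⟩

theorem b_polyM (hN : ∀ i, N.IsStraight i) {S : N.V} (hq : ∀ i, S.q i = 0)
    (P Q : Fin N.nE → Fin 3 → Polynomial ℝ) (U Ω : Fin N.nV → E3) :
    b S (N.polyM P Q U Ω) = ∑ i,
      (-inner ℝ (S.p i) (polyL2 (N.len i) (fun r => (P i r).derivative)
        + crossL2 (N.len i) (N.dir i) (polyL2 (N.len i) (Q i)))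
      + (inner ℝ (S.Pp i) (evalV (P i) (N.len i) - U (N.tgt i))
        - inner ℝ (S.Pm i) (evalV (P i) 0 - U (N.src i)))
      + (inner ℝ (S.Qp i) (evalV (Q i) (N.len i) - Ω (N.tgt i))
        - inner ℝ (S.Qm i) (evalV (Q i) 0 - Ω (N.src i)))
      + inner ℝ S.α (meanL _ (polyL2 (N.len i) (P i)))
      + inner ℝ S.β (meanL _ (polyL2 (N.len i) (Q i)))) := by
  rw [b_eq_sum hN]
  refine Finset.sum_congr rfl fun i _ => ?_
  have h0 := left_mem_Icc.2 (N.len_pos i).le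
  have h1 := right_mem_Icc.2 (N.len_pos i).le
  rw [hq, inner_zero_left, sub_zero, ← polyH1_rep (N.len_pos i) (P i) h0,
    ← polyH1_rep (N.len_pos i) (P i) h1, ← polyH1_rep (N.len_pos i) (Q i) h0,
    ← polyH1_rep (N.len_pos i) (Q i) h1]
  rfl

/-- Infinitesimal rigid motions of the whole network only see the multipliers. -/
theorem b_rigid (hN : ∀ i, N.IsStraight i) {S : N.V} (hq : ∀ i, S.q i = 0) (c e : E3) :
    b S (N.polyM (fun i => affinePoly (c + cross e (N.pos (N.src i))) (cross e (N.dir i)))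
      (fun _ => constPoly e) (fun j => c + cross e (N.pos j)) fun _ => e)
    = ∑ i, (inner ℝ S.α (meanL _ (polyL2 (N.len i)
        (affinePoly (c + cross e (N.pos (N.src i))) (cross e (N.dir i)))))
      + inner ℝ S.β (N.len i • e)) := by
  rw [b_polyM hN hq]
  refine Finset.sum_congr rfl fun i _ => ?_
  -- The strain of a rigid motion vanishes: $v'+t\times w=e\times t+t\times e=0$.
  have h1 : polyL2 (N.len i) (constPoly (cross e (N.dir i)))
      + polyL2 (N.len i) (constPoly (cross (N.dir i) e)) = 0 := by
    rw [← polyL2_add, ← polyL2_zero]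
    congr 1
    ext1 r
    rw [cross_neg_comm (N.dir i) e]
    simp [constPoly]
  -- Straightness makes the motion of the strut's end agree with that of its end vertex.
  have h2 : c + cross e (N.pos (N.src i)) + N.len i • cross e (N.dir i)
      - (c + cross e (N.pos (N.tgt i))) = 0 := by
    have : N.pos (N.tgt i) = N.pos (N.src i) + N.len i • N.dir i := by
      rw [len_smul_dir (hN i)]
      abel
    simp only [this, ← crossLeft_apply, map_add, map_smul]
    abel
  rw [derivative_affinePoly, crossL2_constPoly, h1, evalV_affinePoly, evalV_affinePoly, h2,
    evalV_constPoly, evalV_constPoly, zero_smul, add_zero, sub_self, sub_self,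
    meanL_constPoly (N.len_pos i)]
  simp only [inner_zero_right]
  ring

theorem multipliers_eq_zero (hN : ∀ i, N.IsStraight i) {S : N.V} {k : ℕ} (hq : ∀ i, S.q i = 0)
    (hb : ∀ ψ ∈ N.Mh (k + 1), b S ψ = 0) : S.α = 0 ∧ S.β = 0 := by
  have hmem (c e : E3) := hb _ (polyM_mem (N := N)
    (P := fun i => affinePoly (c + cross e (N.pos (N.src i))) (cross e (N.dir i)))
    (Q := fun _ => constPoly e) (U := fun j => c + cross e (N.pos j)) (Ω := fun _ => e)
    (fun i r => (natDegree_affinePoly_le _ _ r).trans (by omega))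
    fun i r => natDegree_constPoly_le e r _)
  simp only [b_rigid hN hq] at hmem
  have hc0 (x : E3) : cross 0 x = 0 := by rw [cross_neg_comm, cross_zero_right, neg_zero]
  have hα : S.α = 0 := by
    -- Translation by $\alpha$ gives $(\sum_i\ell^i)|\alpha|^2=0$.
    have h := hmem S.α 0
    simp only [hc0, affinePoly_zero, add_zero, smul_zero, inner_zero_right,
      meanL_constPoly (N.len_pos _), inner_smul_right, ← Finset.sum_mul] at h
    exact inner_self_eq_zero.1 ((mul_eq_zero.1 h).resolve_left N.sum_len_pos.ne')
  refine ⟨hα, ?_⟩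
  -- With $\alpha=0$ known, the rotation with axis $\beta$ gives $(\sum_i\ell^i)|\beta|^2=0$.
  have h := hmem 0 S.β
  simp only [hα, inner_zero_left, zero_add, inner_smul_right, ← Finset.sum_mul] at h
  exact inner_self_eq_zero.1 ((mul_eq_zero.1 h).resolve_left N.sum_len_pos.ne')

/-- Test with the displacement $v$ satisfying $v'=P_+-p$ and $v(0)=P_+-P_-$, which has degree at
most $k+1$. Since $v(\ell)=v(0)+\int v'$, each edge contributes $\|P_+-p\|^2+|P_+-P_-|^2$. -/
theorem force_eq_const (hN : ∀ i, N.IsStraight i) {S : N.V} {k : ℕ} (hS : S ∈ N.Vh k)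
    (hq : ∀ i, S.q i = 0) (hα : S.α = 0) (hb : ∀ ψ ∈ N.Mh (k + 1), b S ψ = 0) (i : Fin N.nE) :
    S.p i = polyL2 (N.len i) (constPoly (S.Pp i)) ∧ S.Pp i = S.Pm i := by
  choose P hP hp using fun i => isEdgePoly_iff.1 (hS i).2
  set G : Fin N.nE → Fin 3 → Polynomial ℝ := fun i => constPoly (S.Pp i) + (-1 : ℝ) • P i with hG
  have hGd (i : Fin N.nE) (r : Fin 3) : (G i r).natDegree ≤ k :=
    (Polynomial.natDegree_add_le _ _).trans (max_le (natDegree_constPoly_le _ r k)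
      ((Polynomial.natDegree_smul_le _ _).trans (hP i r)))
  have hGL (i : Fin N.nE) : polyL2 (N.len i) (G i)
      = polyL2 (N.len i) (constPoly (S.Pp i)) - S.p i := by
    rw [hG, polyL2_add, polyL2_smul, neg_one_smul, ← hp, sub_eq_add_neg]
  set F : Fin N.nE → Fin 3 → Polynomial ℝ := fun i r =>
    polyPrimitive (G i r) + constPoly (S.Pp i - S.Pm i) r with hF
  have hFd (i : Fin N.nE) : (fun r => (F i r).derivative) = G i := by
    ext1 r
    simp [hF, derivative_polyPrimitive, constPoly]
  have hF0 (i : Fin N.nE) : evalV (F i) 0 = S.Pp i - S.Pm i := by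
    ext r
    simp [hF, polyPrimitive_eval_zero, constPoly]
  have hFl (i : Fin N.nE) : evalV (F i) (N.len i)
      = S.Pp i - S.Pm i + meanL _ (polyL2 (N.len i) (G i)) := by
    rw [← polyH1_rep (N.len_pos i) _ (right_mem_Icc.2 (N.len_pos i).le), H1.rep_len (N.len_pos i),
      polyH1_rep (N.len_pos i) _ (left_mem_Icc.2 (N.len_pos i).le), hF0, polyH1_deriv, hFd]
  have h := hb _ (polyM_mem (N := N) (P := F) (Q := 0) (U := 0) (Ω := 0)
    (fun i r => (Polynomial.natDegree_add_le _ _).trans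
      (max_le (natDegree_polyPrimitive_le (hGd i r)) (natDegree_constPoly_le _ r _)))
    fun i r => by simp)
  rw [b_polyM hN hq] at h
  have hterm : ∑ i, (inner ℝ (polyL2 (N.len i) (G i)) (polyL2 (N.len i) (G i))
      + inner ℝ (S.Pp i - S.Pm i) (S.Pp i - S.Pm i)) = (0 : ℝ) := by
    rw [← h]
    refine Finset.sum_congr rfl fun i _ => ?_
    have hz (s : ℝ) : evalV (0 : Fin 3 → Polynomial ℝ) s = 0 := by
      ext r
      simp
    simp only [hFd, hF0, hFl, hα, Pi.zero_apply, polyL2_zero, map_zero, add_zero, hz, sub_zero,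
      inner_zero_left, inner_zero_right, inner_add_right]
    rw [← inner_constPoly]
    nth_rw 1 [hGL]
    rw [inner_sub_left, inner_sub_left]
    ring
  have hi := (Finset.sum_eq_zero_iff_of_nonneg fun i _ => add_nonneg real_inner_self_nonneg
    real_inner_self_nonneg).1 hterm i (Finset.mem_univ i)
  rw [add_eq_zero_iff_of_nonneg real_inner_self_nonneg real_inner_self_nonneg,
    inner_self_eq_zero, inner_self_eq_zero, hGL, sub_eq_zero, sub_eq_zero] at hi
  exact ⟨hi.1.symm, hi.2⟩

/-- For constant $p=P_+$ one has $\int p\cdot(t\times w)=(P_+\times t)\cdot\int w$, so a rotation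
enters only through its mean and its end values. -/
theorem b_rotation (hN : ∀ i, N.IsStraight i) {S : N.V} (hq : ∀ i, S.q i = 0) (hβ : S.β = 0)
    (hp : ∀ i, S.p i = polyL2 (N.len i) (constPoly (S.Pp i)))
    (Q : Fin N.nE → Fin 3 → Polynomial ℝ) :
    b S (N.polyM 0 Q 0 0) = ∑ i,
      (-inner ℝ (cross (S.Pp i) (N.dir i)) (meanL _ (polyL2 (N.len i) (Q i)))
        + (inner ℝ (S.Qp i) (evalV (Q i) (N.len i)) - inner ℝ (S.Qm i) (evalV (Q i) 0))) := by
  rw [b_polyM hN hq]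
  refine Finset.sum_congr rfl fun i _ => ?_
  have hz (s : ℝ) : evalV (0 : Fin 3 → Polynomial ℝ) s = 0 := by
    ext r
    simp
  have hd : polyL2 (N.len i) (fun _ => 0) = 0 := polyL2_zero
  rw [hp, hβ, ← inner_cross_cycle, ← meanL_crossL2]
  simp only [Pi.zero_apply, hz, hd, polyL2_zero, map_zero, sub_zero, sub_self, zero_add,
    inner_zero_right, inner_zero_left, add_zero, inner_constPoly]

/-- The bubble $w=s(\ell-s)\,(P_+\times t)$ vanishes at both ends, so the end moments drop out and
$\tfrac{\ell^3}{6}|P_+\times t|^2$ remains, up to sign. Having degree $2$, it is admissible because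
$k\ge 1$. -/
theorem cross_force_eq_zero (hN : ∀ i, N.IsStraight i) {S : N.V} {k : ℕ} (hk : 1 ≤ k)
    (hq : ∀ i, S.q i = 0) (hβ : S.β = 0)
    (hp : ∀ i, S.p i = polyL2 (N.len i) (constPoly (S.Pp i)))
    (hb : ∀ ψ ∈ N.Mh (k + 1), b S ψ = 0) (i : Fin N.nE) : cross (S.Pp i) (N.dir i) = 0 := by
  have h := hb _ (polyM_mem (N := N) (P := 0)
    (Q := fun i => bubblePoly (N.len i) (cross (S.Pp i) (N.dir i))) (U := 0) (Ω := 0)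
    (fun i r => by simp) fun i r => (natDegree_bubblePoly_le _ _ r).trans (by omega))
  rw [b_rotation hN hq hβ hp, ← neg_eq_zero, ← Finset.sum_neg_distrib] at h
  simp only [evalV_bubblePoly, sub_self, mul_zero, zero_mul, zero_smul, inner_zero_right, add_zero,
    neg_neg, meanL_bubblePoly (N.len_pos _), inner_smul_right] at h
  have hpos (i : Fin N.nE) : 0 < N.len i ^ 3 / 6 := by have := N.len_pos i; positivity
  have hi := (Finset.sum_eq_zero_iff_of_nonneg fun i _ => mul_nonneg (hpos i).le
    real_inner_self_nonneg).1 h i (Finset.mem_univ i)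
  exact inner_self_eq_zero.1 ((mul_eq_zero.1 hi).resolve_left (hpos i).ne')

theorem end_moments_eq_zero (hN : ∀ i, N.IsStraight i) {S : N.V} {k : ℕ}
    (hq : ∀ i, S.q i = 0) (hβ : S.β = 0)
    (hp : ∀ i, S.p i = polyL2 (N.len i) (constPoly (S.Pp i)))
    (hc : ∀ i, cross (S.Pp i) (N.dir i) = 0)
    (hb : ∀ ψ ∈ N.Mh (k + 1), b S ψ = 0) (i : Fin N.nE) : S.Qp i = 0 ∧ S.Qm i = 0 := by
  -- The affine rotation with values $-Q_-$ at the start and $Q_+$ at the end turns the end terms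
  -- into $|Q_+|^2+|Q_-|^2$.
  have h := hb _ (polyM_mem (N := N) (P := 0)
    (Q := fun i => affinePoly (-S.Qm i) ((N.len i)⁻¹ • (S.Qp i + S.Qm i))) (U := 0) (Ω := 0)
    (fun i r => by simp) fun i r => (natDegree_affinePoly_le _ _ r).trans (by omega))
  rw [b_rotation hN hq hβ hp] at h
  have hl (i : Fin N.nE) : -S.Qm i + N.len i • (N.len i)⁻¹ • (S.Qp i + S.Qm i) = S.Qp i := by
    rw [smul_inv_smul₀ (N.len_pos i).ne']
    abel
  simp only [evalV_affinePoly, hl, hc, inner_zero_left, neg_zero, zero_add, zero_smul, add_zero,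
    inner_neg_right, sub_neg_eq_add] at h
  have hi := (Finset.sum_eq_zero_iff_of_nonneg fun i _ => add_nonneg real_inner_self_nonneg
    real_inner_self_nonneg).1 h i (Finset.mem_univ i)
  rwa [add_eq_zero_iff_of_nonneg real_inner_self_nonneg real_inner_self_nonneg,
    inner_self_eq_zero, inner_self_eq_zero] at hi

theorem balance (hN : ∀ i, N.IsStraight i) {S : N.V} {n : ℕ} (hq : ∀ i, S.q i = 0)
    (hb : ∀ ψ ∈ N.Mh n, b S ψ = 0) : incPlus S.Pp - incMinus S.Pm = 0 := by
  set U : N.VertexVec := incPlus S.Pp - incMinus S.Pm with hU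
  -- Only the vertices move, by minus the residual force; the minus sign cancels the one in front of
  -- the vertex term of $b$.
  have h := hb _ (polyM_mem (N := N) (P := 0) (Q := 0) (U := fun j => -U j) (Ω := 0)
    (fun i r => by simp) fun i r => by simp)
  have hz (s : ℝ) : evalV (0 : Fin 3 → Polynomial ℝ) s = 0 := by
    ext r
    simp
  have hd (i : Fin N.nE) : polyL2 (N.len i) (fun _ => 0) = 0 := polyL2_zero
  rw [b_polyM hN hq] at h
  simp only [Pi.zero_apply, hz, hd, polyL2_zero, map_zero, zero_add, sub_self, inner_zero_right,
    add_zero, neg_zero, sub_neg_eq_add, Finset.sum_sub_distrib] at h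
  rw [← inner_incPlus, ← inner_incMinus, ← inner_sub_left] at h
  exact inner_self_eq_zero.1 h

theorem eq_zero_of_q_eq_zero (hN : ∀ i, N.IsStraight i) (hgeo : N.GeometryCondition) {S : N.V}
    {k : ℕ} (hk : 1 ≤ k) (hS : S ∈ N.Vh k) (hq : ∀ i, S.q i = 0)
    (hb : ∀ ψ ∈ N.Mh (k + 1), b S ψ = 0) : S = 0 := by
  obtain ⟨hα, hβ⟩ := multipliers_eq_zero hN hq hb
  have hp := fun i => (force_eq_const hN hS hq hα hb i).1
  have hPm := fun i => (force_eq_const hN hS hq hα hb i).2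
  have hc := cross_force_eq_zero hN hk hq hβ hp hb
  have hQ := end_moments_eq_zero hN hq hβ hp hc hb
  -- From $t\times(P\times t)=P-(t\cdot P)\,t$ for the unit vector $t$.
  have haxial (i : Fin N.nE) : S.Pp i = inner ℝ (N.dir i) (S.Pp i) • N.dir i := by
    have := cross_cross_self (S.Pp i) (N.dir i)
    rw [hc, cross_zero_right, inner_dir, one_smul] at this
    exact sub_eq_zero.1 this.symm
  have hbal := balance hN hq hb
  have h0 := hgeo (fun i => inner ℝ (N.dir i) (S.Pp i)) fun j => by
    have hj := congrArg (fun W : N.VertexVec => W j) hbal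
    simp only [hN, and_true]
    refine Eq.trans ?_ hj
    refine congrArg₂ (· - ·) (Finset.sum_congr (by congr) fun i _ => ?_)
      (Finset.sum_congr (by congr) fun i _ => ?_)
    · exact (haxial i).symm
    · exact (haxial i).symm.trans (hPm i)
  have hP (i : Fin N.nE) : S.Pp i = 0 := by
    rw [haxial, h0 i (hN i), zero_smul]
  refine V.ext hq (fun i => ?_) hP (fun i => ?_) (fun i => (hQ i).1) (fun i => (hQ i).2) hα hβ
  · rw [hp, hP, constPoly_zero, polyL2_zero]
    rfl
  · rw [← hPm, hP]
    rfl

end Stent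

/-! ### Quasi-optimality of Galerkin solutions -/

/-- If the bilinear form `B` is nondegenerate on a finite-dimensional subspace `W`, Galerkin
approximations from `W` are quasi-optimal. -/
theorem exists_galerkin_bound {X : Type*} [NormedAddCommGroup X] [NormedSpace ℝ X]
    (W : Submodule ℝ X) [FiniteDimensional ℝ W] (B : X →ₗ[ℝ] X →L[ℝ] ℝ)
    (hB : ∀ w ∈ W, (∀ z ∈ W, B z w = 0) → w = 0) :
    ∃ c : ℝ, 0 < c ∧ ∀ x, ∀ w ∈ W, (∀ z ∈ W, B z (x - w) = 0) → ∀ y ∈ W,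
      ‖x - w‖ ≤ c * ‖x - y‖ := by
  let e := Module.finBasis ℝ W
  -- Testing against a basis of $W$ collects all Galerkin equations in one bounded map on $X$. It is
  -- injective on $W$ by nondegeneracy, hence bounded below there, with constant $K$.
  let Λ : X →L[ℝ] (Fin (Module.finrank ℝ W) → ℝ) := ContinuousLinearMap.pi fun j => B (e j)
  have hinj : LinearMap.ker (Λ.toLinearMap.comp W.subtype) = ⊥ := by
    refine LinearMap.ker_eq_bot'.2 fun w hw => Subtype.ext (hB w w.2 fun z hz => ?_)
    have h : (ContinuousLinearMap.apply ℝ ℝ (w : X)).toLinearMap.comp (B.comp W.subtype) = 0 :=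
      e.ext fun j => congrFun hw j
    exact LinearMap.congr_fun h ⟨z, hz⟩
  obtain ⟨K, hK0, hK⟩ := (Λ.toLinearMap.comp W.subtype).exists_antilipschitzWith hinj
  refine ⟨1 + K * ‖Λ‖, by positivity, fun x w hw h y hy => ?_⟩
  -- Galerkin orthogonality: $\Lambda$ cannot distinguish $w$ from $x$, so $w-y$ is controlled by
  -- $\Lambda(x-y)$.
  have h0 : Λ (x - w) = 0 := funext fun j => h _ (e j).2
  have h1 : Λ (w - y) = Λ (x - y) := by
    rw [← sub_add_sub_cancel x w y, map_add, h0, zero_add]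
  have h2 : ‖w - y‖ ≤ K * ‖Λ (x - y)‖ := by
    rw [← h1]
    have := hK.le_mul_dist (⟨w, hw⟩ : W) ⟨y, hy⟩
    rwa [Subtype.dist_eq, dist_eq_norm, dist_eq_norm, ← map_sub] at this
  calc ‖x - w‖ = ‖(x - y) - (w - y)‖ := by rw [sub_sub_sub_cancel_right]
    _ ≤ ‖x - y‖ + ‖w - y‖ := norm_sub_le _ _
    _ ≤ ‖x - y‖ + K * (‖Λ‖ * ‖x - y‖) := by
      gcongr
      exact h2.trans (by gcongr; exact Λ.le_opNorm _)
    _ = (1 + K * ‖Λ‖) * ‖x - y‖ := by ring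

section Mixed

variable {V M : Type*} [NormedAddCommGroup V] [InnerProductSpace ℝ V] [NormedAddCommGroup M]
  [NormedSpace ℝ M]

/-- The form of the mixed problem given by the operators `A` and `R`, as a function of the test
element and the solution. -/
def mixedForm (A : V →L[ℝ] V) (R : M →L[ℝ] V) : (V × M) →ₗ[ℝ] (V × M) →L[ℝ] ℝ where
  toFun z := (innerSL ℝ z.1).comp (A.coprod R)
    + (innerSL ℝ (R z.2)).comp (ContinuousLinearMap.fst ℝ V M)
  map_add' z z' := by
    ext x <;> simp
    ring
  map_smul' c z := by
    ext x <;> simp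

theorem mixedForm_apply (A : V →L[ℝ] V) (R : M →L[ℝ] V) (z x : V × M) :
    mixedForm A R z x = inner ℝ z.1 (A x.1 + R x.2) + inner ℝ (R z.2) x.1 := rfl

/-- Quasi-optimality for mixed problems with a finite-dimensional trial space on which the
homogeneous problem has only the trivial solution. -/
theorem exists_mixed_bound (A : V →L[ℝ] V) (R : M →L[ℝ] V) (W : Submodule ℝ V)
    (Y : Submodule ℝ M) [FiniteDimensional ℝ W] [FiniteDimensional ℝ Y]
    (hu : ∀ S ∈ W, ∀ φ ∈ Y, (∀ T ∈ W, inner ℝ T (A S + R φ) = 0) →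
      (∀ ψ ∈ Y, inner ℝ (R ψ) S = 0) → S = 0 ∧ φ = 0) :
    ∃ c : ℝ, 0 < c ∧ ∀ (S : V) (φ : M), ∀ Sh ∈ W, ∀ φh ∈ Y,
      (∀ T ∈ W, inner ℝ T (A S + R φ) = inner ℝ T (A Sh + R φh)) →
      (∀ ψ ∈ Y, inner ℝ (R ψ) S = inner ℝ (R ψ) Sh) → ∀ T ∈ W, ∀ ψ ∈ Y,
        ‖S - Sh‖ + ‖φ - φh‖ ≤ c * (‖S - T‖ + ‖φ - ψ‖) := by
  have : FiniteDimensional ℝ (W.prod Y) :=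
    Module.Finite.iff_fg.2 (.prod (Module.Finite.iff_fg.1 ‹_›) (Module.Finite.iff_fg.1 ‹_›))
  obtain ⟨c, hc, h⟩ := exists_galerkin_bound (W.prod Y) (mixedForm A R)
    (fun w hw hz => by
      simp only [mixedForm_apply] at hz
      obtain ⟨h1, h2⟩ := hu w.1 hw.1 w.2 hw.2
        (fun T hT => by simpa using hz (T, 0) ⟨hT, Y.zero_mem⟩)
        fun ψ hψ => by simpa using hz (0, ψ) ⟨W.zero_mem, hψ⟩
      exact Prod.ext h1 h2)
  -- The factor $2$ passes from the maximum norm on the product to the sum of the two norms.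
  refine ⟨2 * c, by positivity, fun S φ Sh hSh φh hφh h1 h2 T hT ψ hψ => ?_⟩
  have key := h (S, φ) (Sh, φh) ⟨hSh, hφh⟩
    (fun z hz => by
      rw [map_sub, sub_eq_zero, mixedForm_apply, mixedForm_apply]
      exact congrArg₂ (· + ·) (h1 z.1 hz.1) (h2 z.2 hz.2))
    (T, ψ) ⟨hT, hψ⟩
  have e1 : ‖S - Sh‖ ≤ ‖(S, φ) - (Sh, φh)‖ := norm_fst_le ((S, φ) - (Sh, φh))
  have e2 : ‖φ - φh‖ ≤ ‖(S, φ) - (Sh, φh)‖ := norm_snd_le ((S, φ) - (Sh, φh))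
  have e3 : ‖(S, φ) - (T, ψ)‖ ≤ ‖S - T‖ + ‖φ - ψ‖ :=
    max_le_add_of_nonneg (norm_nonneg _) (norm_nonneg _)
  have e4 := mul_le_mul_of_nonneg_left e3 hc.le
  linarith

end Mixed

/-! ### The polynomial trial spaces and quasi-optimality on the network -/

namespace Stent

attribute [local instance] innerV normedSpaceM

variable {N : Stent}

/-- `V_k` as a subspace. -/
def VhSub (N : Stent) (k : ℕ) : Submodule ℝ N.V where
  carrier := N.Vh k
  zero_mem' := fun _ => ⟨mem_polySub.1 (zero_mem _), mem_polySub.1 (zero_mem _)⟩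
  add_mem' := fun hS hT i =>
    ⟨mem_polySub.1 (add_mem (mem_polySub.2 (hS i).1) (mem_polySub.2 (hT i).1)),
      mem_polySub.1 (add_mem (mem_polySub.2 (hS i).2) (mem_polySub.2 (hT i).2))⟩
  smul_mem' := fun c _ hS i =>
    ⟨mem_polySub.1 (Submodule.smul_mem _ c (mem_polySub.2 (hS i).1)),
      mem_polySub.1 (Submodule.smul_mem _ c (mem_polySub.2 (hS i).2))⟩

/-- `M_n` as a subspace. -/
def MhSub (N : Stent) (n : ℕ) : Submodule ℝ N.M where
  carrier := N.Mh n
  zero_mem' := fun _ => ⟨mem_polySub.1 (zero_mem _), mem_polySub.1 (zero_mem _)⟩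
  add_mem' := fun hS hT i =>
    ⟨mem_polySub.1 (add_mem (mem_polySub.2 (hS i).1) (mem_polySub.2 (hT i).1)),
      mem_polySub.1 (add_mem (mem_polySub.2 (hS i).2) (mem_polySub.2 (hT i).2))⟩
  smul_mem' := fun c _ hS i =>
    ⟨mem_polySub.1 (Submodule.smul_mem _ c (mem_polySub.2 (hS i).1)),
      mem_polySub.1 (Submodule.smul_mem _ c (mem_polySub.2 (hS i).2))⟩

instance (k : ℕ) : FiniteDimensional ℝ (N.VhSub k) := by
  let g : N.VhSub k →ₗ[ℝ] (∀ i, polySub k (N.len i)) × (∀ i, polySub k (N.len i)) ×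
      WithLp 2 (N.EdgeVec × WithLp 2 (N.EdgeVec × WithLp 2 (N.EdgeVec ×
        WithLp 2 (N.EdgeVec × WithLp 2 (E3 × E3))))) :=
    { toFun := fun S => (fun i => ⟨S.1.q i, mem_polySub.2 (S.2 i).1⟩,
        fun i => ⟨S.1.p i, mem_polySub.2 (S.2 i).2⟩,
        S.1.snd.snd)
      map_add' := fun _ _ => rfl
      map_smul' := fun _ _ => rfl }
  refine FiniteDimensional.of_injective g fun S T h => Subtype.ext ?_
  have h1 := congrArg (fun x => x.1) h
  have h2 := congrArg (fun x => x.2.1) h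
  have h3 : S.1.snd.snd = T.1.snd.snd := congrArg (fun x => x.2.2) h
  exact WithLp.ofLp_injective 2 <| Prod.ext
    (PiLp.ext fun i => congrArg Subtype.val (congrFun h1 i)) <|
    WithLp.ofLp_injective 2 <| Prod.ext
      (PiLp.ext fun i => congrArg Subtype.val (congrFun h2 i)) h3

instance (n : ℕ) : FiniteDimensional ℝ (N.MhSub n) := by
  -- Weak derivatives need not be recorded, since the underlying function determines an element of
  -- $H^1$.
  let g : N.MhSub n →ₗ[ℝ] (∀ i, polySub n (N.len i)) × (∀ i, polySub n (N.len i)) ×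
      WithLp 2 (N.VertexVec × N.VertexVec) :=
    { toFun := fun φ => (fun i => ⟨(φ.1.u i).fn, mem_polySub.2 (φ.2 i).1⟩,
        fun i => ⟨(φ.1.ω i).fn, mem_polySub.2 (φ.2 i).2⟩, φ.1.snd.snd)
      map_add' := fun _ _ => rfl
      map_smul' := fun _ _ => rfl }
  refine FiniteDimensional.of_injective g fun φ ψ h => Subtype.ext ?_
  have h1 := congrArg (fun x => x.1) h
  have h2 := congrArg (fun x => x.2.1) h
  have h3 : φ.1.snd.snd = ψ.1.snd.snd := congrArg (fun x => x.2.2) h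
  exact WithLp.ofLp_injective 2 <| Prod.ext
    (PiLp.ext fun i => H1.ext_fn (congrArg Subtype.val (congrFun h1 i))) <|
    WithLp.ofLp_injective 2 <| Prod.ext
      (PiLp.ext fun i => H1.ext_fn (congrArg Subtype.val (congrFun h2 i))) h3

theorem inner_ops (hN : ∀ i, N.IsStraight i) (S T : N.V) (φ : N.M) :
    inner ℝ T (N.aOp S + N.bOp φ) = a S T + b T φ := by
  rw [inner_add_right, a_eq_inner, b_eq_inner hN, real_inner_comm (N.aOp S),
    real_inner_comm (N.bOp φ)]

/-- Uniqueness in the homogeneous discrete problem, apart from the lowest-order case. -/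
theorem discrete_unique (hN : ∀ i, N.IsStraight i) (hgeo : N.GeometryCondition) {k : ℕ}
    (hk : 1 ≤ k) {S : N.V} {φ : N.M} (hS : S ∈ N.Vh k) (hφ : φ ∈ N.Mh (k + 1))
    (h1 : ∀ T ∈ N.Vh k, a S T + b T φ = 0) (h2 : ∀ ψ ∈ N.Mh (k + 1), b S ψ = 0) :
    S = 0 ∧ φ = 0 := by
  -- Test with $\Sigma$ itself; the second equation at $\varphi$ removes the term
  -- $b(\Sigma,\varphi)$.
  have hq := q_eq_zero_of_a_eq_zero (S := S) (by simpa [h2 φ hφ] using h1 S hS)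
  refine ⟨eq_zero_of_q_eq_zero hN hgeo hk hS hq h2, eq_zero_of_forall_b_eq_zero hN hφ fun T hT => ?_⟩
  simpa [a_eq_zero_of_q hq] using h1 T hT

set_option maxHeartbeats 1000000 in
-- The method is conforming, so the continuous equations may be tested with discrete functions;
-- subtraction gives Galerkin orthogonality.
theorem exists_quasiOptimal (hN : ∀ i, N.IsStraight i) {k n : ℕ}
    (hu : ∀ S ∈ N.Vh k, ∀ φ ∈ N.Mh n, (∀ T ∈ N.Vh k, a S T + b T φ = 0) →
      (∀ ψ ∈ N.Mh n, b S ψ = 0) → S = 0 ∧ φ = 0) :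
    ∃ c : ℝ, 0 < c ∧ ∀ (f : N.L2Net) (S : N.V) (φ : N.M) (Sh : N.V) (φh : N.M),
      IsSolution f S φ → IsDiscreteSolution f k n Sh φh → ∀ T ∈ N.Vh k, ∀ ψ ∈ N.Mh n,
        ‖S - Sh‖ + ‖φ - φh‖ ≤ c * (‖S - T‖ + ‖φ - ψ‖) := by
  obtain ⟨c, hc, h⟩ := exists_mixed_bound N.aOp N.bOp (N.VhSub k) (N.MhSub n)
    fun S hS φ hφ h1 h2 => hu S hS φ hφ (fun T hT => (inner_ops hN S T φ).symm.trans (h1 T hT))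
      fun ψ hψ => (b_eq_inner hN S ψ).trans (h2 ψ hψ)
  refine ⟨c, hc, fun f S φ Sh φh hs hd => ?_⟩
  obtain ⟨hSh, hφh, hd1, hd2⟩ := hd
  refine h S φ Sh hSh φh hφh (fun T hT => ?_) fun ψ hψ => ?_
  · rw [inner_ops hN, inner_ops hN, hs.1, hd1 T hT]
  · rw [← b_eq_inner hN, ← b_eq_inner hN, hs.2, hd2 ψ hψ]

/-- If some discrete problem has a unique solution, the homogeneous one has only the trivial
solution. -/
theorem homogeneous_of_unique (hN : ∀ i, N.IsStraight i) {k n : ℕ} {f : N.L2Net} {Sh : N.V}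
    {φh : N.M} (hd : IsDiscreteSolution f k n Sh φh)
    (hu : ∀ (S' : N.V) (φ' : N.M), IsDiscreteSolution f k n S' φ' → S' = Sh ∧ φ' = φh) {S : N.V}
    {φ : N.M} (hS : S ∈ N.Vh k) (hφ : φ ∈ N.Mh n) (h1 : ∀ T ∈ N.Vh k, a S T + b T φ = 0)
    (h2 : ∀ ψ ∈ N.Mh n, b S ψ = 0) : S = 0 ∧ φ = 0 := by
  obtain ⟨hSh, hφh, hd1, hd2⟩ := hd
  -- A homogeneous solution added to the given one solves the same discrete problem.
  have h := hu (Sh + S) (φh + φ) ⟨(N.VhSub k).add_mem hSh hS, (N.MhSub n).add_mem hφh hφ,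
    fun T hT => by
      have e1 := h1 T hT
      have e2 := hd1 T hT
      rw [a_eq_inner, b_eq_inner hN] at e1 e2 ⊢
      rw [map_add, map_add, inner_add_left, inner_add_left]
      linarith,
    fun ψ hψ => by
      have e1 := h2 ψ hψ
      have e2 := hd2 ψ hψ
      rw [b_eq_inner hN] at e1 e2 ⊢
      rw [inner_add_right, e1, e2, add_zero]⟩
  exact ⟨add_eq_left.1 h.1, add_eq_left.1 h.2⟩

end Stent

end

/-! ### The quasi-optimal error estimate -/

theorem theorem4p5 (N : Stent) (hstraight : ∀ i, N.IsStraight i) (hgeo : N.GeometryCondition)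
    (k n : ℕ) (hn : n = k + 1) :
    ∃ c : ℝ, 0 < c ∧
      ∀ (f : N.L2Net) (S : N.V) (φ : N.M) (Sh : N.V) (φh : N.M),
        Stent.IsSolution f S φ →
        Stent.IsDiscreteSolution f k n Sh φh →
        (k = 0 → ∀ (S' : N.V) (φ' : N.M),
          Stent.IsDiscreteSolution f k n S' φ' → S' = Sh ∧ φ' = φh) →
        ‖S - Sh‖ + ‖φ - φh‖ ≤
          c * ((⨅ T : N.Vh k, ‖S - T‖) + ⨅ ψ : N.Mh n, ‖φ - ψ‖) := by
  -- The constant must be fixed before any solution is given, whereas for $k=0$ uniqueness is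
  -- assumed only together with a solution. If the homogeneous problem has a nontrivial solution,
  -- the premises are contradictory and any constant serves.
  by_cases hu : ∀ S ∈ N.Vh k, ∀ φ ∈ N.Mh n,
      (∀ T ∈ N.Vh k, Stent.a S T + Stent.b T φ = 0) →
      (∀ ψ ∈ N.Mh n, Stent.b S ψ = 0) → S = 0 ∧ φ = 0
  · obtain ⟨c, hc, h⟩ := Stent.exists_quasiOptimal hstraight hu
    refine ⟨c, hc, fun f S φ Sh φh hs hd _ => ?_⟩
    have : Nonempty (N.Vh k) := ⟨⟨0, (N.VhSub k).zero_mem⟩⟩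
    have : Nonempty (N.Mh n) := ⟨⟨0, (N.MhSub n).zero_mem⟩⟩
    rw [mul_comm, ← div_le_iff₀ hc]
    -- The bound holds for each pair $(T,\psi)$ separately, so it passes to the sum of the two
    -- infima.
    refine le_ciInf_add_ciInf fun T ψ => ?_
    rw [div_le_iff₀ hc, mul_comm]
    exact h f S φ Sh φh hs hd T T.2 ψ ψ.2
  · refine ⟨1, one_pos, fun f S φ Sh φh _ hd huniq => (hu fun S' hS φ' hφ h1 h2 => ?_).elim⟩
    rcases Nat.eq_zero_or_pos k with hk | hk
    · exact Stent.homogeneous_of_unique hstraight hd (huniq hk) hS hφ h1 h2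
    · subst hn
      exact Stent.discrete_unique hstraight hgeo hk hS hφ h1 h2
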